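/- Let $L$ be a natural number, $u>0$ and $\tau\in\mathbb R$. On the fermionic Fock space of the modes $(i,\sigma)$, where $i$ runs over the sites of the $L\times L$ square lattice with periodic boundary conditions and $\sigma\in\{\uparrow,\downarrow\}$, let $a_{i\sigma}$ be the annihilation operators and $z_{i\sigma}=2a^\dagger_{i\sigma}a_{i\sigma}-1$. Put $$H_h=\sum_{\sigma}\sum_{i\ne j}R_{ij}\,a^\dagger_{i\sigma}a_{j\sigma},\qquad H_I=\frac u4\sum_i z_{i\uparrow}z_{i\downarrow},\qquad H=H_h+H_I,$$ where $R_{ij}=\tau$ if $i$ and $j$ are distinct nearest neighbours on the lattice and $R_{ij}=0$ otherwise. Let $\|\cdot\|$ be the operator norm, $\|\cdot\|_1$ the trace norm, and $$W_{SO1}=\tfrac1{12}\|[[H_h,H_I],H_I]\|+\tfrac1{24}\|[[H_h,H_I],H_h]\|,\qquad W_{SO2}=\tfrac1{12}\|[[H_I,H_h],H_h]\|+\tfrac1{24}\|[[H_I,H_h],H_I]\|.$$ Then for every $t\ge 0$ $$\big\|e^{iHt}-e^{iH_ht/2}e^{iH_It}e^{iH_ht/2}\big\|\le W_{SO1}t^3,\qquad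 \big\|e^{iHt}-e^{iH_It/2}e^{iH_ht}e^{iH_It/2}\big\|\le W_{SO2}t^3,$$ and $$W_{SO1}\le\frac{u^2}{12}\|H_h\|+\frac{u\tau^2}{12}L^2(\sqrt5+8),\qquad W_{SO2}\le\frac{u\tau^2}{6}L^2(\sqrt5+8)+\frac{u^2}{24}\|H_h\|,$$ where moreover $\|H_h\|=\|R\|_1$, the sum of the absolute values of the eigenvalues of the $L^2\times L^2$ matrix $R$. -/

import Mathlib

open scoped Matrix Matrix.Norms.L2Operator

noncomputable section

/-- Operators on the fermionic Fock space of a finite set `α` of modes, written as matrices in the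
occupation-number basis. The basis state of `S : Finset α` has exactly the modes of `S` filled.
The norm on these matrices is the operator norm of the Euclidean norm. -/
abbrev FockOp (α : Type*) := Matrix (Finset α) (Finset α) ℂ

/-- The annihilation operator `a_m`: it empties the mode `m` if it is filled, with the sign
`(-1) ^ (number of filled modes before m)`, and kills the states in which `m` is empty. -/
def annihilate {α : Type*} [LinearOrder α] (m : α) : FockOp α :=
  Matrix.of fun S T =>
    if m ∈ T ∧ S = T.erase m then (-1) ^ (T.filter (fun k => k < m)).card else 0

/-- The creation operator `a†_m`, the adjoint of `a_m`. -/
def create {α : Type*} [LinearOrder α] (m : α) : FockOp α := (annihilate m)ᴴ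

/-- The number operator `n_m = a†_m a_m`. -/
def numberOp {α : Type*} [Fintype α] [LinearOrder α] (m : α) : FockOp α :=
  create m * annihilate m

/-- `z_m = 2 n_m - 1`. -/
def zOp {α : Type*} [Fintype α] [LinearOrder α] (m : α) : FockOp α :=
  (2 : ℂ) • numberOp m - 1

/-- Modes of spin-1/2 fermions on the sites `Λ`: a site with a spin (`true` is up, `false` is down).
The lexicographic order only fixes the signs in the annihilation operators. -/
abbrev Mode (Λ : Type*) := Λ ×ₗ Bool

/-- The mode at site `i` with spin `σ`. -/
def mode {Λ : Type*} (i : Λ) (σ : Bool) : Mode Λ := toLex (i, σ)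

/-- `H_h = ∑_σ ∑_{i ≠ j} R_{ij} a†_{iσ} a_{jσ}`. -/
def hopping {Λ : Type*} [Fintype Λ] [LinearOrder Λ] (R : Matrix Λ Λ ℂ) : FockOp (Mode Λ) :=
  ∑ σ : Bool, ∑ i : Λ, ∑ j ∈ Finset.univ.erase i,
    R i j • (create (mode i σ) * annihilate (mode j σ))

/-- `H_I = (u/4) ∑_i z_{i↑} z_{i↓}`. -/
def interaction (Λ : Type*) [Fintype Λ] [LinearOrder Λ] (u : ℝ) : FockOp (Mode Λ) :=
  ((u / 4 : ℝ) : ℂ) • ∑ i : Λ, zOp (mode i true) * zOp (mode i false)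

/-- The sites of the `L × L` lattice. -/
abbrev Site (L : ℕ) := Fin L ×ₗ Fin L

/-- The nearest-neighbour graph of the periodic `L × L` square lattice (the product of two
cycles). -/
def torusGraph (L : ℕ) : SimpleGraph (Fin L × Fin L) :=
  (SimpleGraph.cycleGraph L).boxProd (SimpleGraph.cycleGraph L)

open Classical in
/-- The hopping matrix: `τ` between nearest neighbours, `0` otherwise. -/
def latticeR (L : ℕ) (τ : ℝ) : Matrix (Site L) (Site L) ℂ :=
  Matrix.of fun i j => if (torusGraph L).Adj (ofLex i) (ofLex j) then (τ : ℂ) else 0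

theorem latticeR_isHermitian (L : ℕ) (τ : ℝ) : (latticeR L τ).IsHermitian := by
  ext i j
  by_cases h : (torusGraph L).Adj (ofLex i) (ofLex j)
  · simp [latticeR, h, h.symm]
  · have h' : ¬ (torusGraph L).Adj (ofLex j) (ofLex i) := fun k => h k.symm
    simp [latticeR, h, h']

/-- The hopping Hamiltonian of the periodic `L × L` square lattice. -/
def Hh (L : ℕ) (τ : ℝ) : FockOp (Mode (Site L)) := hopping (latticeR L τ)

/-- The interaction Hamiltonian of the `L × L` square lattice. -/
def HI (L : ℕ) (u : ℝ) : FockOp (Mode (Site L)) := interaction (Site L) u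

/-- The trace norm (Schatten 1-norm) of a Hermitian matrix. -/
def hermitianTraceNorm {n : Type*} [Fintype n] [DecidableEq n] {A : Matrix n n ℂ}
    (hA : A.IsHermitian) : ℝ :=
  ∑ k, |hA.eigenvalues k|

/-- The unitary `e^{i H t}`. -/
def evolution {n : Type*} [Fintype n] [DecidableEq n] (H : Matrix n n ℂ) (t : ℝ) :
    Matrix n n ℂ :=
  NormedSpace.exp ((Complex.I * (t : ℂ)) • H)

/-- The second-order Trotter step `e^{i H₁ t/2} e^{i H₂ t} e^{i H₁ t/2}`. -/
def trotterStep {n : Type*} [Fintype n] [DecidableEq n] (H₁ H₂ : Matrix n n ℂ) (t : ℝ) :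
    Matrix n n ℂ :=
  evolution H₁ (t / 2) * evolution H₂ t * evolution H₁ (t / 2)

/-- The commutator constant of the second-order Trotter step with the ordered terms `H₁`, `H₂`. -/
def trotterConst {n : Type*} [Fintype n] [DecidableEq n] (H₁ H₂ : Matrix n n ℂ) : ℝ :=
  ‖⁅⁅H₁, H₂⁆, H₂⁆‖ / 12 + ‖⁅⁅H₁, H₂⁆, H₁⁆‖ / 24

/-- The constant of the ordering with the hopping terms outside. -/
def WSO1 (L : ℕ) (u τ : ℝ) : ℝ := trotterConst (Hh L τ) (HI L u)

/-- The constant of the ordering with the interaction terms outside. -/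
def WSO2 (L : ℕ) (u τ : ℝ) : ℝ := trotterConst (HI L u) (Hh L τ)

end

/-! The Trotter product `S(s)` satisfies `S' = S(A+B) + E`, where `E` is unitarily equivalent in
size to a difference of two Taylor remainders of conjugations. The symmetric splitting cancels their
first-order terms, so `‖E‖` is at most `3s²` times the commutator constant, and integration gives
`t³` (`norm_exp_sub_trotter_le`).

The commutator with two copies of `H_I` is read off in the occupation basis: `H_I` is diagonal and a
hop changes `∑ z↑z↓` by `0` or `±4`, so the double commutator is `(u²/2)(H_h - W H_h W†)` with `W` a
diagonal unitary (`norm_lie_lie_interaction_le`).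

The commutator with two copies of `H_h` is bounded site by site. Second quantization respects
commutators (`IsCAR.lie_secondQuant`), so for one spin everything reduces to matrices of small rank
built from `e_i`, `R e_i` and `R² e_i`. Up to scalars, which cancel, their second quantizations are
controlled by `norm_secondQuant_symm_le`; `lie_lie_mul_eq` then combines the two spins. On the torus
this yields the constant `10`, and `10 ≤ √5 + 8`.

Finally, diagonalizing `R` turns `H_h` into independent modes, each eigenvalue occurring once per
spin. As `R` has trace zero, `H_h = ∑ ε_k (n_k - 1/2)`, whose norm is attained by filling exactly
the modes with `ε_k ≥ 0`. -/

noncomputable section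

/-! ### Second-order Trotter error in a Banach algebra. -/

section Abstract

variable {𝒜 : Type*} [NormedRing 𝒜] [NormedAlgebra ℝ 𝒜] [CompleteSpace 𝒜]

theorem hasDerivAt_exp_conj (X Y : 𝒜) (t : ℝ) :
    HasDerivAt (fun s : ℝ => NormedSpace.exp (s • (-X)) * Y * NormedSpace.exp (s • X))
      (NormedSpace.exp (t • (-X)) * ⁅Y, X⁆ * NormedSpace.exp (t • X)) t := by
  have h1 := hasDerivAt_exp_smul_const (𝕂 := ℝ) (-X) t
  have h2 := hasDerivAt_exp_smul_const' (𝕂 := ℝ) X t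
  refine ((h1.mul_const Y).mul h2).congr_deriv ?_
  rw [Ring.lie_def]
  noncomm_ring

omit [CompleteSpace 𝒜] in
theorem norm_exp_conj_le {X : 𝒜} (hX : ∀ t : ℝ, ‖NormedSpace.exp (t • X)‖ ≤ 1) (Y : 𝒜) (t : ℝ) :
    ‖NormedSpace.exp (t • (-X)) * Y * NormedSpace.exp (t • X)‖ ≤ ‖Y‖ := by
  have h1 : ‖NormedSpace.exp (t • (-X))‖ ≤ 1 := by
    have := hX (-t)
    rwa [neg_smul, ← smul_neg] at this
  calc _ ≤ ‖NormedSpace.exp (t • (-X))‖ * ‖Y‖ * ‖NormedSpace.exp (t • X)‖ :=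
        (norm_mul_le _ _).trans (by gcongr; exact norm_mul_le _ _)
    _ ≤ 1 * ‖Y‖ * 1 := by gcongr; exact hX t
    _ = ‖Y‖ := by ring

/-- Comparing derivatives replaces integration: each remainder estimate below follows from the one
an order lower. -/
theorem norm_le_of_hasDerivAt_of_le {E : Type*} [NormedAddCommGroup E] [NormedSpace ℝ E]
    {f f' : ℝ → E} {B B' : ℝ → ℝ} (hf : ∀ s, HasDerivAt f (f' s) s)
    (hB : ∀ s, HasDerivAt B (B' s) s) (h0 : ‖f 0‖ ≤ B 0)
    (hle : ∀ s, 0 ≤ s → ‖f' s‖ ≤ B' s) {t : ℝ} (ht : 0 ≤ t) : ‖f t‖ ≤ B t :=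
  image_norm_le_of_norm_deriv_right_le_deriv_boundary (a := 0) (b := t)
    (fun s _ => (hf s).continuousAt.continuousWithinAt)
    (fun s _ => (hf s).hasDerivWithinAt) h0 hB (fun s hs => hle s hs.1) ⟨ht, le_rfl⟩

theorem norm_exp_conj_sub_le {X : 𝒜} (hX : ∀ t : ℝ, ‖NormedSpace.exp (t • X)‖ ≤ 1) (Y : 𝒜)
    {t : ℝ} (ht : 0 ≤ t) :
    ‖NormedSpace.exp (t • (-X)) * Y * NormedSpace.exp (t • X) - Y‖ ≤ ‖⁅Y, X⁆‖ * t := by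
  refine norm_le_of_hasDerivAt_of_le
    (f := fun s => NormedSpace.exp (s • (-X)) * Y * NormedSpace.exp (s • X) - Y)
    (B := fun s => ‖⁅Y, X⁆‖ * s) (B' := fun _ => ‖⁅Y, X⁆‖)
    (fun s => (hasDerivAt_exp_conj X Y s).sub_const Y)
    (fun s => by simpa using (hasDerivAt_id s).const_mul ‖⁅Y, X⁆‖) (by simp)
    (fun s _ => norm_exp_conj_le hX _ s) ht

/-- The derivative of this remainder is the first-order remainder for `⁅Y, X⁆`. -/
theorem norm_exp_conj_sub_sub_le {X : 𝒜} (hX : ∀ t : ℝ, ‖NormedSpace.exp (t • X)‖ ≤ 1) (Y : 𝒜)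
    {t : ℝ} (ht : 0 ≤ t) :
    ‖NormedSpace.exp (t • (-X)) * Y * NormedSpace.exp (t • X) - Y - t • ⁅Y, X⁆‖ ≤
      ‖⁅⁅Y, X⁆, X⁆‖ * (t ^ 2 / 2) := by
  refine norm_le_of_hasDerivAt_of_le
    (f := fun s => NormedSpace.exp (s • (-X)) * Y * NormedSpace.exp (s • X) - Y - s • ⁅Y, X⁆)
    (B := fun s => ‖⁅⁅Y, X⁆, X⁆‖ * (s ^ 2 / 2)) (B' := fun s => ‖⁅⁅Y, X⁆, X⁆‖ * s)
    (f' := fun s => NormedSpace.exp (s • (-X)) * ⁅Y, X⁆ * NormedSpace.exp (s • X) - ⁅Y, X⁆)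
    (fun s => ?_) (fun s => ?_) (by simp)
    (fun s hs => norm_exp_conj_sub_le hX _ hs) ht
  · refine (((hasDerivAt_exp_conj X Y s).sub_const Y).sub
      ((hasDerivAt_id s).smul_const ⁅Y, X⁆)).congr_deriv (by simp)
  · refine (((hasDerivAt_pow 2 s).div_const 2).const_mul ‖⁅⁅Y, X⁆, X⁆‖).congr_deriv ?_
    simp

theorem exp_smul_neg_mul_exp_smul (X : 𝒜) (t : ℝ) :
    NormedSpace.exp (t • (-X)) * NormedSpace.exp (t • X) = 1 := by
  let _ : NormedAlgebra ℚ 𝒜 := NormedAlgebra.restrictScalars ℚ ℝ 𝒜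
  rw [← NormedSpace.exp_add_of_commute, smul_neg, neg_add_cancel, NormedSpace.exp_zero]
  rw [smul_neg]
  exact (Commute.refl (t • X)).neg_left

theorem exp_smul_mul_exp_smul_neg (X : 𝒜) (t : ℝ) :
    NormedSpace.exp (t • X) * NormedSpace.exp (t • (-X)) = 1 := by
  simpa using exp_smul_neg_mul_exp_smul (-X) t

-- Here `e = exp(sA/2)`, `b = exp(sB)`, with inverses `e'`, `b'`. The product rule for `e b e` is on
-- the left; on the right `A + B` has been moved to the far right and the defect collected between
-- `e b` and `e`.
omit [CompleteSpace 𝒜] in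
theorem trotter_deriv_identity {A B e e' b b' : 𝒜} (hb : b * b' = 1) (he : e' * e = 1)
    (hA : A * e = e * A) :
    ((1 / 2 : ℝ) • (e * A) * b + e * (b * B)) * e + e * b * ((1 / 2 : ℝ) • (e * A)) =
      e * b * e * (A + B) +
        e * b * ((1 / 2 : ℝ) • (b' * A * b - A) + B - e * B * e') * e := by
  have h1 : e * b * (b' * A * b) * e = e * A * b * e := by
    rw [show e * b * (b' * A * b) * e = e * (b * b') * A * b * e by noncomm_ring, hb, mul_one]
  have h2 : e * b * (e * B * e') * e = e * b * e * B := by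
    rw [show e * b * (e * B * e') * e = e * b * e * B * (e' * e) by noncomm_ring, he, mul_one]
  have h3 : e * b * A * e = e * b * e * A := by
    rw [mul_assoc (e * b), hA]
    noncomm_ring
  simp only [mul_sub, mul_add, sub_mul, add_mul, mul_smul_comm, smul_mul_assoc, smul_sub, h1, h2,
    h3]
  simp only [← mul_assoc]
  module

/-- The second-order Trotter error bound with commutator constants. -/
theorem norm_exp_sub_trotter_le {A B : 𝒜} (hA : ∀ t : ℝ, ‖NormedSpace.exp (t • A)‖ ≤ 1)
    (hB : ∀ t : ℝ, ‖NormedSpace.exp (t • B)‖ ≤ 1)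
    (hAB : ∀ t : ℝ, ‖NormedSpace.exp (t • (A + B))‖ ≤ 1) {t : ℝ} (ht : 0 ≤ t) :
    ‖NormedSpace.exp (t • (A + B)) - NormedSpace.exp ((t / 2) • A) * NormedSpace.exp (t • B) *
        NormedSpace.exp ((t / 2) • A)‖ ≤
      (‖⁅⁅A, B⁆, B⁆‖ / 12 + ‖⁅⁅A, B⁆, A⁆‖ / 24) * t ^ 3 := by
  set K := ‖⁅⁅A, B⁆, B⁆‖ / 12 + ‖⁅⁅A, B⁆, A⁆‖ / 24 with hK
  have hA' : ∀ s : ℝ, ‖NormedSpace.exp (s • (-A))‖ ≤ 1 := fun s => by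
    have := hA (-s)
    rwa [neg_smul, ← smul_neg] at this
  have hexpA : ∀ s : ℝ, HasDerivAt (fun s : ℝ => NormedSpace.exp ((s / 2) • A))
      ((1 / 2 : ℝ) • (NormedSpace.exp ((s / 2) • A) * A)) s := fun s =>
    HasDerivAt.scomp (h := fun s : ℝ => s / 2) s
      (hasDerivAt_exp_smul_const (𝕂 := ℝ) A (s / 2)) ((hasDerivAt_id s).div_const 2)
  let S : ℝ → 𝒜 := fun s => NormedSpace.exp ((s / 2) • A) * NormedSpace.exp (s • B) *
        NormedSpace.exp ((s / 2) • A)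
  -- The two linear terms cancel because `⁅B, -A⁆ = ⁅A, B⁆`; keeping them displays `F` as two
  -- second-order remainders.
  let F : ℝ → 𝒜 := fun s =>
    (1 / 2 : ℝ) • (NormedSpace.exp (s • (-B)) * A * NormedSpace.exp (s • B) - A - s • ⁅A, B⁆)
      - (NormedSpace.exp ((s / 2) • (- -A)) * B * NormedSpace.exp ((s / 2) • (-A)) - B
          - (s / 2) • ⁅B, -A⁆)
  have hF : ∀ s, 0 ≤ s → ‖F s‖ ≤ K * (3 * s ^ 2) := fun s hs => by
    have h1 := norm_exp_conj_sub_sub_le hB A hs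
    have h2 := norm_exp_conj_sub_sub_le hA' B (by positivity : (0 : ℝ) ≤ s / 2)
    have h3 : ⁅⁅B, -A⁆, -A⁆ = -⁅⁅A, B⁆, A⁆ := by
      simp only [Ring.lie_def]
      noncomm_ring
    rw [h3, norm_neg] at h2
    refine (norm_sub_le _ _).trans ?_
    rw [norm_smul, Real.norm_of_nonneg (by norm_num : (0 : ℝ) ≤ 1 / 2)]
    calc _ ≤ 1 / 2 * (‖⁅⁅A, B⁆, B⁆‖ * (s ^ 2 / 2)) + ‖⁅⁅A, B⁆, A⁆‖ * ((s / 2) ^ 2 / 2) := by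
          gcongr
      _ = _ := by rw [hK]; ring
  let E : ℝ → 𝒜 := fun s => NormedSpace.exp ((s / 2) • A) * NormedSpace.exp (s • B) * F s *
      NormedSpace.exp ((s / 2) • A)
  have hE : ∀ s, 0 ≤ s → ‖E s‖ ≤ K * (3 * s ^ 2) := fun s hs => by
    have h1 : ‖E s‖ ≤ ‖NormedSpace.exp ((s / 2) • A)‖ * ‖NormedSpace.exp (s • B)‖ * ‖F s‖ *
        ‖NormedSpace.exp ((s / 2) • A)‖ := by
      refine (norm_mul_le _ _).trans ?_
      gcongr
      refine (norm_mul_le _ _).trans ?_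
      gcongr
      exact norm_mul_le _ _
    have h2 : ‖NormedSpace.exp ((s / 2) • A)‖ * ‖NormedSpace.exp (s • B)‖ * ‖F s‖ *
        ‖NormedSpace.exp ((s / 2) • A)‖ ≤ 1 * 1 * ‖F s‖ * 1 := by
      gcongr
      · exact hA _
      · exact hB _
      · exact hA _
    have h3 := hF s hs
    linarith
  have hS : ∀ s, HasDerivAt S (S s * (A + B) + E s) s := fun s => by
    refine (((hexpA s).mul (hasDerivAt_exp_smul_const (𝕂 := ℝ) B s)).mul
      (hexpA s)).congr_deriv ?_
    have hF' : F s = (1 / 2 : ℝ) • (NormedSpace.exp (s • (-B)) * A * NormedSpace.exp (s • B) - A)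
        + B - NormedSpace.exp ((s / 2) • A) * B * NormedSpace.exp ((s / 2) • (-A)) := by
      simp only [F, neg_neg, Ring.lie_def, mul_neg, neg_mul]
      module
    have hc : A * NormedSpace.exp ((s / 2) • A) = NormedSpace.exp ((s / 2) • A) * A :=
      (((Commute.refl A).smul_right (s / 2)).exp_right).eq
    simp only [E, S, hF']
    exact trotter_deriv_identity (exp_smul_mul_exp_smul_neg B s)
      (exp_smul_neg_mul_exp_smul A (s / 2)) hc
  -- Multiplying by the inverse evolution removes the term `S (A + B)`, leaving only the defect.
  have hD : ∀ s, HasDerivAt (fun s => S s * NormedSpace.exp (s • (-(A + B))) - 1)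
      (E s * NormedSpace.exp (s • (-(A + B)))) s := fun s => by
    refine (((hS s).mul (hasDerivAt_exp_smul_const' (𝕂 := ℝ) (-(A + B)) s)).sub_const
      1).congr_deriv ?_
    noncomm_ring
  have hAB' : ∀ s : ℝ, ‖NormedSpace.exp (s • (-(A + B)))‖ ≤ 1 := fun s => by
    have := hAB (-s)
    rwa [neg_smul, ← smul_neg] at this
  have key : ‖S t * NormedSpace.exp (t • (-(A + B))) - 1‖ ≤ K * t ^ 3 := by
    refine norm_le_of_hasDerivAt_of_le (B := fun s => K * s ^ 3)
      (B' := fun s => K * (3 * s ^ 2)) hD (fun s => ?_) ?_ (fun s hs => ?_) ht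
    · simpa using (hasDerivAt_pow 3 s).const_mul K
    · simp [S]
    · calc _ ≤ ‖E s‖ * ‖NormedSpace.exp (s • (-(A + B)))‖ := norm_mul_le _ _
        _ ≤ (K * (3 * s ^ 2)) * 1 := by
          gcongr
          · exact hE s hs
          · exact hAB' s
        _ = _ := mul_one _
  have heq : NormedSpace.exp (t • (A + B)) - S t =
      -((S t * NormedSpace.exp (t • (-(A + B))) - 1) * NormedSpace.exp (t • (A + B))) := by
    rw [sub_mul, mul_assoc, exp_smul_neg_mul_exp_smul]
    simp
  change ‖NormedSpace.exp (t • (A + B)) - S t‖ ≤ _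
  rw [heq, norm_neg]
  calc _ ≤ _ := norm_mul_le _ _
    _ ≤ K * t ^ 3 * 1 := by
      gcongr
      · exact hAB t
    _ = _ := mul_one _

end Abstract

/-! ### Unitary evolutions generated by Hermitian matrices. -/

section Evolution

variable {n : Type*} [Fintype n] [DecidableEq n]

theorem norm_exp_smul_le_one {H : Matrix n n ℂ} (hH : H.IsHermitian) (t : ℝ) :
    ‖NormedSpace.exp (t • (Complex.I • H))‖ ≤ 1 := by
  let _ : NormedAlgebra ℚ (Matrix n n ℂ) := NormedAlgebra.restrictScalars ℚ ℂ (Matrix n n ℂ)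
  have hmem : t • (Complex.I • H) ∈ skewAdjoint (Matrix n n ℂ) := by
    rw [skewAdjoint.mem_iff, star_smul, star_smul, Matrix.star_eq_conjTranspose, hH.eq]
    simp
  have hU := NormedSpace.exp_mem_unitary_of_mem_skewAdjoint hmem
  have h := CStarRing.norm_star_mul_self (x := NormedSpace.exp (t • (Complex.I • H)))
  rw [Unitary.star_mul_self_of_mem hU] at h
  -- For an empty index type the matrix ring is trivial and `1` has norm `0`.
  cases isEmpty_or_nonempty n
  · rw [Subsingleton.elim (NormedSpace.exp (t • (Complex.I • H))) 0, norm_zero]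
    exact zero_le_one
  · rw [CStarRing.norm_one] at h
    nlinarith

theorem evolution_eq (H : Matrix n n ℂ) (t : ℝ) :
    evolution H t = NormedSpace.exp (t • (Complex.I • H)) := by
  rw [evolution, mul_comm, mul_smul]
  rfl

theorem norm_evolution_sub_trotterStep_le {H₁ H₂ : Matrix n n ℂ} (h₁ : H₁.IsHermitian)
    (h₂ : H₂.IsHermitian) {t : ℝ} (ht : 0 ≤ t) :
    ‖evolution (H₁ + H₂) t - trotterStep H₁ H₂ t‖ ≤ trotterConst H₁ H₂ * t ^ 3 := by
  have h := norm_exp_sub_trotter_le (norm_exp_smul_le_one h₁) (norm_exp_smul_le_one h₂)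
    (fun t => by rw [← smul_add]; exact norm_exp_smul_le_one (h₁.add h₂) t) ht
  have hn : ∀ X Y Z : Matrix n n ℂ,
      ‖⁅⁅Complex.I • X, Complex.I • Y⁆, Complex.I • Z⁆‖ = ‖⁅⁅X, Y⁆, Z⁆‖ := fun X Y Z => by
    have : ⁅⁅Complex.I • X, Complex.I • Y⁆, Complex.I • Z⁆ =
        (Complex.I * Complex.I * Complex.I) • ⁅⁅X, Y⁆, Z⁆ := by
      simp only [Ring.lie_def, smul_mul_assoc, mul_smul_comm, sub_mul, mul_sub, smul_sub,
        smul_smul, mul_assoc]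
    rw [this, norm_smul]
    simp
  rw [hn, hn, ← smul_add] at h
  simpa only [trotterStep, evolution_eq, trotterConst] using h

end Evolution

/-! ### Anticommutation relations and second quantization. -/

section CAR

/-- The canonical anticommutation relations for a family of elements of a star ring. -/
structure IsCAR {ι 𝒜 : Type*} [DecidableEq ι] [Ring 𝒜] [StarRing 𝒜] (a : ι → 𝒜) : Prop where
  mul_add_mul : ∀ i j, a i * a j + a j * a i = 0
  mul_star_add : ∀ i j, a i * star (a j) + star (a j) * a i = if i = j then 1 else 0

/-- Two families all of whose members, and their adjoints, anticommute with each other. -/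
structure Anticommuting {ι κ 𝒜 : Type*} [Ring 𝒜] [StarRing 𝒜] (a : ι → 𝒜) (b : κ → 𝒜) :
    Prop where
  mul_add_mul : ∀ i j, a i * b j + b j * a i = 0
  mul_star_add : ∀ i j, a i * star (b j) + star (b j) * a i = 0

variable {ι κ 𝒜 : Type*} [Fintype ι] [Fintype κ] [Ring 𝒜] [StarRing 𝒜] [Algebra ℂ 𝒜]

/-- The second quantization `∑ M_ij a†_i a_j` of the matrix `M`. -/
def secondQuant (a : ι → 𝒜) : Matrix ι ι ℂ →ₗ[ℂ] 𝒜 where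
  toFun M := ∑ i, ∑ j, M i j • (star (a i) * a j)
  map_add' M N := by simp [add_smul, Finset.sum_add_distrib]
  map_smul' c M := by simp [Finset.smul_sum, smul_smul]

theorem secondQuant_apply (a : ι → 𝒜) (M : Matrix ι ι ℂ) :
    secondQuant a M = ∑ i, ∑ j, M i j • (star (a i) * a j) := rfl

/-- The annihilation operator of the one-particle state `f`. -/
def field (a : ι → 𝒜) (f : ι → ℂ) : 𝒜 := ∑ j, star (f j) • a j

theorem star_field [StarModule ℂ 𝒜] (a : ι → 𝒜) (f : ι → ℂ) :
    star (field a f) = ∑ j, f j • star (a j) := by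
  simp [field, star_sum, star_smul]

theorem star_field_mul_field [StarModule ℂ 𝒜] (a : ι → 𝒜) (f g : ι → ℂ) :
    star (field a f) * field a g = secondQuant a (Matrix.vecMulVec f (star g)) := by
  rw [star_field, field, secondQuant_apply, Finset.sum_mul_sum]
  simp [Matrix.vecMulVec_apply, smul_smul, mul_comm]

omit [StarRing 𝒜] in
theorem field_single [DecidableEq ι] (a : ι → 𝒜) (i : ι) : field a (Pi.single i 1) = a i := by
  rw [field, Finset.sum_eq_single i]
  · simp
  · intro j _ hj
    simp [hj]
  · simp

namespace IsCAR

omit [Fintype ι] [Fintype κ] [Algebra ℂ 𝒜] in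
theorem comp [DecidableEq ι] [DecidableEq κ] {a : ι → 𝒜} (ha : IsCAR a) {e : κ → ι}
    (he : Function.Injective e) : IsCAR (a ∘ e) where
  mul_add_mul i j := ha.mul_add_mul _ _
  mul_star_add i j := by simp [ha.mul_star_add, he.eq_iff]

omit [Fintype ι] [Fintype κ] [Algebra ℂ 𝒜] in
theorem anticommuting [DecidableEq ι] {κ' : Type*} {a : ι → 𝒜} (ha : IsCAR a) {e : κ → ι}
    {e' : κ' → ι} (h : ∀ i j, e i ≠ e' j) : Anticommuting (a ∘ e) (a ∘ e') where
  mul_add_mul i j := ha.mul_add_mul _ _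
  mul_star_add i j := by simp [ha.mul_star_add, h]

omit [Fintype ι] [Fintype κ] [Algebra ℂ 𝒜] in
theorem sumElim [DecidableEq ι] [DecidableEq κ] {a : ι → 𝒜} {b : κ → 𝒜} (ha : IsCAR a)
    (hb : IsCAR b) (hab : Anticommuting a b) : IsCAR (Sum.elim a b) where
  mul_add_mul i j := by
    rcases i with i | i <;> rcases j with j | j
    · exact ha.mul_add_mul _ _
    · exact hab.mul_add_mul _ _
    · simpa only [Sum.elim_inl, Sum.elim_inr, add_comm] using hab.mul_add_mul j i
    · exact hb.mul_add_mul _ _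
  mul_star_add i j := by
    rcases i with i | i <;> rcases j with j | j
    · simpa using ha.mul_star_add i j
    · simpa using hab.mul_star_add i j
    · have := congrArg star (hab.mul_star_add j i)
      simpa [add_comm] using this
    · simpa using hb.mul_star_add i j

variable [DecidableEq ι] {a : ι → 𝒜} (ha : IsCAR a)

include ha in
omit [Fintype ι] in
theorem mul_self (i : ι) : a i * a i = 0 := by
  have h := ha.mul_add_mul i i
  rw [← two_smul ℂ] at h
  exact (smul_eq_zero_iff_right (two_ne_zero)).mp h

include ha in
theorem field_mul_field (f g : ι → ℂ) :
    field a f * field a g + field a g * field a f = 0 := by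
  rw [field, field, Finset.sum_mul_sum, Finset.sum_mul_sum, Finset.sum_comm (s := Finset.univ),
    ← Finset.sum_add_distrib]
  refine Finset.sum_eq_zero fun i _ => ?_
  rw [← Finset.sum_add_distrib]
  refine Finset.sum_eq_zero fun j _ => ?_
  rw [smul_mul_smul_comm, smul_mul_smul_comm, mul_comm (star (g i)), ← smul_add,
    ha.mul_add_mul, smul_zero]

include ha in
theorem field_mul_star_field [StarModule ℂ 𝒜] (f g : ι → ℂ) :
    field a f * star (field a g) + star (field a g) * field a f =
      (star f ⬝ᵥ g) • (1 : 𝒜) := by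
  rw [star_field, field, Finset.sum_mul_sum, Finset.sum_mul_sum,
    Finset.sum_comm (s := Finset.univ), ← Finset.sum_add_distrib]
  rw [dotProduct, Finset.sum_smul]
  refine Finset.sum_congr rfl fun i _ => ?_
  rw [← Finset.sum_add_distrib, Finset.sum_eq_single i]
  · rw [smul_mul_smul_comm, smul_mul_smul_comm, mul_comm (g i), ← smul_add,
      ha.mul_star_add, if_pos rfl, Pi.star_apply]
  · intro j _ hj
    rw [smul_mul_smul_comm, smul_mul_smul_comm, mul_comm (g i), ← smul_add,
      ha.mul_star_add, if_neg hj, smul_zero]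
  · simp

-- Normal ordering both products leaves the same quartic term, since swapping creators and swapping
-- annihilators give two signs. Only the contractions survive.
include ha in
omit [Fintype ι] [Algebra ℂ 𝒜] in
theorem lie_bilinear (i j k l : ι) :
    ⁅star (a i) * a j, star (a k) * a l⁆ =
      (if j = k then star (a i) * a l else 0) - if i = l then star (a k) * a j else 0 := by
  have h1 : a j * star (a k) = (if j = k then 1 else 0) - star (a k) * a j :=
    eq_sub_of_add_eq (ha.mul_star_add j k)
  have h2 : a l * star (a i) = (if l = i then 1 else 0) - star (a i) * a l :=
    eq_sub_of_add_eq (ha.mul_star_add l i)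
  have h3 : a j * a l = -(a l * a j) := eq_neg_of_add_eq_zero_left (ha.mul_add_mul j l)
  have h4 : star (a i) * star (a k) = -(star (a k) * star (a i)) := by
    have := congrArg star (ha.mul_add_mul k i)
    simp only [star_add, star_mul, star_zero] at this
    exact eq_neg_of_add_eq_zero_left this
  have e1 : star (a i) * a j * (star (a k) * a l) =
      (if j = k then star (a i) * a l else 0) - star (a i) * star (a k) * (a j * a l) := by
    rw [show star (a i) * a j * (star (a k) * a l) = star (a i) * (a j * star (a k)) * a l by
      noncomm_ring, h1]
    split_ifs <;> noncomm_ring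
  have e2 : star (a k) * a l * (star (a i) * a j) =
      (if i = l then star (a k) * a j else 0) - star (a k) * star (a i) * (a l * a j) := by
    rw [show star (a k) * a l * (star (a i) * a j) = star (a k) * (a l * star (a i)) * a j by
      noncomm_ring, h2]
    simp only [eq_comm (a := i)]
    split_ifs <;> noncomm_ring
  rw [Ring.lie_def, e1, e2, h3, h4]
  noncomm_ring

-- This moves commutators from Fock space to one-particle matrices.
include ha in
theorem lie_secondQuant (M N : Matrix ι ι ℂ) :
    ⁅secondQuant a M, secondQuant a N⁆ = secondQuant a ⁅M, N⁆ := by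
  have h : ⁅secondQuant a M, secondQuant a N⁆ = ∑ i, ∑ j, ∑ k, ∑ l, (M i j * N k l) •
      ⁅star (a i) * a j, star (a k) * a l⁆ := by
    simp only [Ring.lie_def, smul_sub, Finset.sum_sub_distrib]
    congr 1
    · rw [secondQuant_apply, Finset.sum_mul]
      refine Finset.sum_congr rfl fun i _ => ?_
      rw [Finset.sum_mul]
      refine Finset.sum_congr rfl fun j _ => ?_
      simp only [secondQuant_apply, Finset.mul_sum, smul_mul_smul_comm]
    · rw [secondQuant_apply a M, Finset.mul_sum]
      refine Finset.sum_congr rfl fun i _ => ?_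
      rw [Finset.mul_sum]
      refine Finset.sum_congr rfl fun j _ => ?_
      simp only [secondQuant_apply, Finset.sum_mul, smul_mul_smul_comm, mul_comm (M i j)]
  rw [h]
  simp only [ha.lie_bilinear, smul_sub, Finset.sum_sub_distrib, smul_ite, smul_zero]
  rw [Ring.lie_def, map_sub]
  congr 1
  · simp only [secondQuant_apply, Matrix.mul_apply, Finset.sum_smul]
    refine Finset.sum_congr rfl fun i _ => ?_
    rw [Finset.sum_comm (s := Finset.univ (α := ι)) (t := Finset.univ (α := ι))
      (f := fun l j => (M i j * N j l) • (star (a i) * a l))]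
    refine Finset.sum_congr rfl fun j _ => ?_
    rw [Finset.sum_comm]
    simp
  · simp only [secondQuant_apply, Matrix.mul_apply, Finset.sum_smul, Finset.sum_ite_eq,
      Finset.mem_univ, if_true]
    rw [Finset.sum_comm, Finset.sum_comm (s := Finset.univ (α := ι)) (t := Finset.univ (α := ι))
      (f := fun k j => ∑ i, (N k i * M i j) • (star (a k) * a j))]
    refine Finset.sum_congr rfl fun j _ => ?_
    rw [Finset.sum_comm]
    simp only [mul_comm]

end IsCAR

/-- Bilinears are even, so the signs cancel in pairs. -/
theorem Anticommuting.commute_secondQuant {a : ι → 𝒜} {b : κ → 𝒜} (h : Anticommuting a b)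
    (M : Matrix ι ι ℂ) (N : Matrix κ κ ℂ) : Commute (secondQuant a M) (secondQuant b N) := by
  have h1 : ∀ i j, a i * b j = -(b j * a i) := fun i j =>
    eq_neg_of_add_eq_zero_left (h.mul_add_mul i j)
  have h2 : ∀ i j, a i * star (b j) = -(star (b j) * a i) := fun i j =>
    eq_neg_of_add_eq_zero_left (h.mul_star_add i j)
  have h3 : ∀ i j, star (a i) * star (b j) = -(star (b j) * star (a i)) := fun i j => by
    have := congrArg star (h1 i j)
    simp only [star_mul, star_neg] at this
    rw [this, neg_neg]
  have h4 : ∀ i j, star (a i) * b j = -(b j * star (a i)) := fun i j => by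
    have := congrArg star (h2 i j)
    simp only [star_mul, star_neg, star_star] at this
    rw [this, neg_neg]
  rw [secondQuant_apply, secondQuant_apply]
  refine Commute.sum_left _ _ _ fun i _ => Commute.sum_left _ _ _ fun j _ =>
    Commute.sum_right _ _ _ fun k _ => Commute.sum_right _ _ _ fun l _ =>
      (Commute.smul_right (Commute.smul_left ?_ _) _)
  have e1 : Commute (star (a i) * a j) (star (b k)) := by
    rw [commute_iff_eq, mul_assoc, h2, mul_neg, ← mul_assoc, h3, neg_mul, neg_neg, mul_assoc]
  have e2 : Commute (star (a i) * a j) (b l) := by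
    rw [commute_iff_eq, mul_assoc, h1, mul_neg, ← mul_assoc, h4, neg_mul, neg_neg, mul_assoc]
  exact e1.mul_right e2

theorem Anticommuting.field {a : ι → 𝒜} {b : κ → 𝒜} [StarModule ℂ 𝒜] (h : Anticommuting a b)
    {ι' κ' : Type*} (f : ι' → ι → ℂ) (g : κ' → κ → ℂ) :
    Anticommuting (fun i => field a (f i)) (fun j => field b (g j)) where
  mul_add_mul i j := by
    rw [_root_.field, _root_.field, Finset.sum_mul_sum, Finset.sum_mul_sum,
      Finset.sum_comm (s := Finset.univ), ← Finset.sum_add_distrib]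
    refine Finset.sum_eq_zero fun k _ => ?_
    rw [← Finset.sum_add_distrib]
    refine Finset.sum_eq_zero fun l _ => ?_
    rw [smul_mul_smul_comm, smul_mul_smul_comm, mul_comm (star (g j k)), ← smul_add,
      h.mul_add_mul, smul_zero]
  mul_star_add i j := by
    rw [star_field, _root_.field, Finset.sum_mul_sum, Finset.sum_mul_sum,
      Finset.sum_comm (s := Finset.univ), ← Finset.sum_add_distrib]
    refine Finset.sum_eq_zero fun k _ => ?_
    rw [← Finset.sum_add_distrib]
    refine Finset.sum_eq_zero fun l _ => ?_
    rw [smul_mul_smul_comm, smul_mul_smul_comm, mul_comm (g j k), ← smul_add,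
      h.mul_star_add, smul_zero]

end CAR

/-! ### Norms of second-quantized matrices of rank at most two. -/

section Norm

variable {ι κ 𝒜 : Type*} [Fintype ι] [DecidableEq ι] [NormedRing 𝒜] [StarRing 𝒜] [CStarRing 𝒜]
  [NormedAlgebra ℂ 𝒜] [StarModule ℂ 𝒜]

omit [StarModule ℂ 𝒜] in
/-- A self-adjoint square root of a scalar is bounded by the root of the scalar. -/
theorem norm_le_of_sq_eq_smul_one [NormOneClass 𝒜] {x : 𝒜} (hx : star x = x) {k : ℝ} (hk : 0 ≤ k)
    (h : x * x = ((k ^ 2 : ℝ) : ℂ) • (1 : 𝒜)) : ‖x‖ ≤ k := by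
  have h1 := CStarRing.norm_star_mul_self (x := x)
  rw [hx, h, norm_smul, norm_one, Complex.norm_of_nonneg (by positivity)] at h1
  nlinarith [norm_nonneg x]

/-- The relations give `(c†c)² = r c†c`, so the shifted operator squares to `(r/2)²`. -/
theorem norm_star_mul_sub_le [NormOneClass 𝒜] {c : 𝒜} {r : ℝ} (hr : 0 ≤ r) (h0 : c * c = 0)
    (h : c * star c + star c * c = (r : ℂ) • (1 : 𝒜)) :
    ‖star c * c - ((r / 2 : ℝ) : ℂ) • (1 : 𝒜)‖ ≤ r / 2 := by
  refine norm_le_of_sq_eq_smul_one (by simp [star_smul]) (by positivity) ?_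
  have h1 : star c * c * (star c * c) = (r : ℂ) • (star c * c) := by
    have : c * star c = (r : ℂ) • (1 : 𝒜) - star c * c := eq_sub_of_add_eq h
    rw [show star c * c * (star c * c) = star c * (c * star c) * c by noncomm_ring, this, mul_sub,
      sub_mul, show star c * (star c * c) * c = star c * star c * (c * c) by noncomm_ring, h0]
    simp
  simp only [mul_sub, sub_mul, h1, smul_mul_assoc, mul_smul_comm, one_mul, mul_one]
  push_cast
  module

/-- The squared norm of a vector. -/
def normSqVec (f : ι → ℂ) : ℝ := ∑ i, ‖f i‖ ^ 2

omit [DecidableEq ι] in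
theorem star_dotProduct_self (f : ι → ℂ) : star f ⬝ᵥ f = (normSqVec f : ℂ) := by
  simp [normSqVec, dotProduct, Complex.conj_mul']

omit [DecidableEq ι] in
theorem normSqVec_nonneg (f : ι → ℂ) : 0 ≤ normSqVec f := by
  unfold normSqVec; positivity

theorem IsCAR.norm_secondQuant_vecMulVec_le [NormOneClass 𝒜] {a : ι → 𝒜} (ha : IsCAR a)
    (f : ι → ℂ) :
    ‖secondQuant a (Matrix.vecMulVec f (star f)) - ((normSqVec f / 2 : ℝ) : ℂ) • (1 : 𝒜)‖ ≤
      normSqVec f / 2 := by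
  rw [← star_field_mul_field]
  refine norm_star_mul_sub_le (normSqVec_nonneg f) ?_ ?_
  · have h := ha.field_mul_field f f
    rw [← two_smul ℂ] at h
    exact (smul_eq_zero_iff_right two_ne_zero).mp h
  · rw [ha.field_mul_star_field, star_dotProduct_self]

omit [DecidableEq ι] in
theorem normSqVec_add (α β : ℝ) (p s : ι → ℂ) :
    normSqVec ((β : ℂ) • p + (α : ℂ) • s) =
      β ^ 2 * normSqVec p + α ^ 2 * normSqVec s + 2 * α * β * (star p ⬝ᵥ s).re := by
  simp only [normSqVec, dotProduct, Complex.re_sum, Finset.mul_sum, ← Finset.sum_add_distrib]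
  refine Finset.sum_congr rfl fun i _ => ?_
  simp only [← Complex.normSq_eq_norm_sq, Complex.normSq_apply, Pi.add_apply, Pi.smul_apply,
    smul_eq_mul, Complex.add_re, Complex.add_im, Complex.ofReal_re, Complex.ofReal_im,
    Pi.star_apply, Complex.mul_re, Complex.mul_im, RCLike.star_def, Complex.conj_re, Complex.conj_im]
  ring

/-- Polarization: `2αβ(ps* + sp*) = ff* - gg*` with `f, g = βp ± αs`. The weights balance the two
lengths, so that `(‖f‖² + ‖g‖²)/2 ≤ 2α²β²`. -/
theorem IsCAR.norm_secondQuant_symm_le [NormOneClass 𝒜] {a : ι → 𝒜} (ha : IsCAR a)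
    (p s : ι → ℂ) {α β : ℝ} (hα : 0 < α) (hβ : 0 < β) (hp : normSqVec p ≤ α ^ 2)
    (hs : normSqVec s ≤ β ^ 2) :
    ‖secondQuant a (Matrix.vecMulVec p (star s) + Matrix.vecMulVec s (star p))
      - (((star p ⬝ᵥ s).re : ℝ) : ℂ) • (1 : 𝒜)‖ ≤ α * β := by
  set f := (β : ℂ) • p + (α : ℂ) • s with hf
  set g := (β : ℂ) • p + ((-α : ℝ) : ℂ) • s with hg
  have hfn := normSqVec_add α β p s
  have hgn := normSqVec_add (-α) β p s
  rw [← hf] at hfn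
  rw [← hg] at hgn
  have hc : ((2 * α * β : ℝ) : ℂ) • (Matrix.vecMulVec p (star s) + Matrix.vecMulVec s (star p)) =
      Matrix.vecMulVec f (star f) - Matrix.vecMulVec g (star g) := by
    ext i j
    simp [hf, hg, Matrix.vecMulVec_apply]
    ring
  have hq := congrArg (secondQuant a) hc
  rw [map_smul, map_sub] at hq
  set X := secondQuant a (Matrix.vecMulVec p (star s) + Matrix.vecMulVec s (star p)) with hX
  have h1 : ((2 * α * β : ℝ) : ℂ) • (X - (((star p ⬝ᵥ s).re : ℝ) : ℂ) • (1 : 𝒜)) =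
      (secondQuant a (Matrix.vecMulVec f (star f)) - ((normSqVec f / 2 : ℝ) : ℂ) • (1 : 𝒜)) -
      (secondQuant a (Matrix.vecMulVec g (star g)) - ((normSqVec g / 2 : ℝ) : ℂ) • (1 : 𝒜)) := by
    rw [smul_sub, hq, hfn, hgn]
    push_cast
    module
  have h2 : ‖((2 * α * β : ℝ) : ℂ) • (X - (((star p ⬝ᵥ s).re : ℝ) : ℂ) • (1 : 𝒜))‖ ≤
      normSqVec f / 2 + normSqVec g / 2 := by
    rw [h1]
    exact (norm_sub_le _ _).trans (add_le_add (ha.norm_secondQuant_vecMulVec_le f)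
      (ha.norm_secondQuant_vecMulVec_le g))
  rw [norm_smul, Complex.norm_of_nonneg (by positivity), hfn, hgn] at h2
  have h3 : β ^ 2 * normSqVec p ≤ β ^ 2 * α ^ 2 := by gcongr
  have h4 : α ^ 2 * normSqVec s ≤ α ^ 2 * β ^ 2 := by gcongr
  have h5 : 2 * α * β * ‖X - (((star p ⬝ᵥ s).re : ℝ) : ℂ) • (1 : 𝒜)‖ ≤ 2 * α * β * (α * β) := by
    linarith
  exact le_of_mul_le_mul_left h5 (by positivity)

end Norm

/-! ### The norm of a sum of independent modes. -/

section Spectrum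

variable {ι 𝒜 : Type*} [Fintype ι] [DecidableEq ι]

omit [Fintype ι] in
/-- Some nonzero element has any prescribed occupation numbers. -/
theorem IsCAR.exists_occupation [Ring 𝒜] [StarRing 𝒜] [Algebra ℂ 𝒜] [Nontrivial 𝒜] {b : ι → 𝒜}
    (hb : IsCAR b) (δ : ι → Prop) [DecidablePred δ] (s : Finset ι) :
    ∃ P : 𝒜, P ≠ 0 ∧ ∀ k ∈ s, star (b k) * b k * P = if δ k then P else 0 := by
  induction s using Finset.induction_on with
  | empty => exact ⟨1, one_ne_zero, by simp⟩
  | insert k s hk ih =>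
    obtain ⟨P, hP, h⟩ := ih
    have hkk := hb.mul_self k
    have hk1 : b k * star (b k) = 1 - star (b k) * b k :=
      eq_sub_of_add_eq (by simpa using hb.mul_star_add k k)
    have hcomm : ∀ j, j ≠ k → Commute (star (b j) * b j) (b k) := fun j hj => by
      have h1 : b j * b k = -(b k * b j) := eq_neg_of_add_eq_zero_left (hb.mul_add_mul j k)
      have h2 : b k * star (b j) = -(star (b j) * b k) :=
        eq_neg_of_add_eq_zero_left (by simpa [hj.symm] using hb.mul_star_add k j)
      rw [commute_iff_eq, mul_assoc, h1, ← mul_assoc, h2]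
      noncomm_ring
    have hcomm' : ∀ j, j ≠ k → Commute (star (b j) * b j) (star (b k)) := fun j hj => by
      have := (hcomm j hj).star_star
      simpa using this
    have hne : ∀ j ∈ s, j ≠ k := fun j hj e => hk (e ▸ hj)
    by_cases hδ : δ k
    -- If creation kills `P`, the mode is already filled; otherwise `star (b k) * P` fills it.
    -- Working with elements of the algebra avoids any vacuum vector.
    · by_cases h0 : star (b k) * P = 0
      · refine ⟨P, hP, fun j hj => ?_⟩
        rcases Finset.mem_insert.mp hj with rfl | hj
        · rw [if_pos hδ]
          have : b j * star (b j) * P = 0 := by rw [mul_assoc, h0, mul_zero]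
          rw [hk1, sub_mul, one_mul, sub_eq_zero] at this
          exact this.symm
        · exact h j hj
      · refine ⟨star (b k) * P, h0, fun j hj => ?_⟩
        rcases Finset.mem_insert.mp hj with rfl | hj
        · have hs : star (b j) * star (b j) = 0 := by rw [← star_mul, hkk, star_zero]
          rw [if_pos hδ, show star (b j) * b j * (star (b j) * P) =
            star (b j) * (b j * star (b j)) * P by noncomm_ring, hk1, mul_sub, ← mul_assoc, hs]
          simp
        · rw [← mul_assoc, (hcomm' j (hne j hj)).eq, mul_assoc, h j hj]
          split_ifs <;> simp
    · by_cases h0 : b k * P = 0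
      · refine ⟨P, hP, fun j hj => ?_⟩
        rcases Finset.mem_insert.mp hj with rfl | hj
        · rw [if_neg hδ, mul_assoc, h0, mul_zero]
        · exact h j hj
      · refine ⟨b k * P, h0, fun j hj => ?_⟩
        rcases Finset.mem_insert.mp hj with rfl | hj
        · rw [if_neg hδ, show star (b j) * b j * (b j * P) =
            star (b j) * (b j * b j) * P by noncomm_ring, hkk]
          simp
        · rw [← mul_assoc, (hcomm j (hne j hj)).eq, mul_assoc, h j hj]
          split_ifs <;> simp

theorem IsCAR.norm_sum_smul_eq [NormedRing 𝒜] [StarRing 𝒜] [CStarRing 𝒜] [NormedAlgebra ℂ 𝒜]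
    [StarModule ℂ 𝒜] [Nontrivial 𝒜] {b : ι → 𝒜} (hb : IsCAR b) (ε : ι → ℝ) :
    ‖∑ k, (ε k : ℂ) • (star (b k) * b k - (1 / 2 : ℂ) • (1 : 𝒜))‖ = (∑ k, |ε k|) / 2 := by
  have : NormOneClass 𝒜 := ⟨CStarRing.norm_one⟩
  refine le_antisymm ?_ ?_
  · rw [Finset.sum_div]
    refine (norm_sum_le _ _).trans (Finset.sum_le_sum fun k _ => ?_)
    have h1 : ‖star (b k) * b k - ((1 / 2 : ℝ) : ℂ) • (1 : 𝒜)‖ ≤ 1 / 2 := by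
      refine norm_star_mul_sub_le zero_le_one (hb.mul_self k)
        (by simpa using hb.mul_star_add k k)
    push_cast at h1
    rw [norm_smul, Complex.norm_real, Real.norm_eq_abs]
    calc _ ≤ |ε k| * (1 / 2) := by gcongr
      _ = _ := by ring
  -- With these occupations each term acts on `P` as the scalar `|ε k| / 2`.
  · obtain ⟨P, hP, h⟩ := hb.exists_occupation (fun k => 0 ≤ ε k) Finset.univ
    have h1 : (∑ k, (ε k : ℂ) • (star (b k) * b k - (1 / 2 : ℂ) • (1 : 𝒜))) * P =
        (((∑ k, |ε k|) / 2 : ℝ) : ℂ) • P := by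
      rw [Finset.sum_mul, Finset.sum_div, Complex.ofReal_sum, Finset.sum_smul]
      refine Finset.sum_congr rfl fun k _ => ?_
      rw [smul_mul_assoc, sub_mul, h k (Finset.mem_univ _), smul_mul_assoc, one_mul]
      split_ifs with h0
      · rw [abs_of_nonneg h0]
        push_cast
        module
      · rw [abs_of_neg (not_le.mp h0)]
        push_cast
        module
    have h2 := norm_mul_le (∑ k, (ε k : ℂ) • (star (b k) * b k - (1 / 2 : ℂ) • (1 : 𝒜))) P
    rw [h1, norm_smul, Complex.norm_of_nonneg (by positivity)] at h2
    exact le_of_mul_le_mul_right h2 (norm_pos_iff.mpr hP)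

end Spectrum

/-! ### Anticommutation relations in the occupation basis. -/

section Fock

variable {α : Type*} [LinearOrder α]

/-- The sign in the annihilation operator of the mode `m`. -/
def fockSign (m : α) (T : Finset α) : ℂ := (-1) ^ (T.filter (fun k => k < m)).card

theorem fockSign_mul_self (m : α) (T : Finset α) : fockSign m T * fockSign m T = 1 := by
  rw [fockSign, ← mul_pow]
  simp

theorem star_fockSign (m : α) (T : Finset α) : star (fockSign m T) = fockSign m T := by
  simp [fockSign]

theorem fockSign_insert_of_le {m k : α} (h : m ≤ k) (T : Finset α) :
    fockSign m (insert k T) = fockSign m T := by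
  rw [fockSign, Finset.filter_insert, if_neg h.not_gt, fockSign]

theorem fockSign_insert_of_lt {m k : α} (h : k < m) {T : Finset α} (hk : k ∉ T) :
    fockSign m (insert k T) = -fockSign m T := by
  rw [fockSign, Finset.filter_insert, if_pos h, Finset.card_insert_of_notMem (by simp [hk]),
    pow_succ, fockSign]
  ring

theorem fockSign_erase_of_le {m k : α} (h : m ≤ k) (T : Finset α) :
    fockSign m (T.erase k) = fockSign m T := by
  by_cases hk : k ∈ T
  · conv_rhs => rw [← Finset.insert_erase hk]
    rw [fockSign_insert_of_le h]
  · rw [Finset.erase_eq_of_notMem hk]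

theorem fockSign_erase_of_lt {m k : α} (h : k < m) {T : Finset α} (hk : k ∈ T) :
    fockSign m (T.erase k) = -fockSign m T := by
  conv_rhs => rw [← Finset.insert_erase hk]
  rw [fockSign_insert_of_lt h (Finset.notMem_erase k T), neg_neg]

theorem annihilate_apply (m : α) (S T : Finset α) :
    annihilate m S T = if m ∈ T ∧ S = T.erase m then fockSign m T else 0 := rfl

theorem create_apply (m : α) (S T : Finset α) :
    create m S T = if m ∉ T ∧ S = insert m T then fockSign m T else 0 := by
  rw [create, Matrix.conjTranspose_apply, annihilate_apply]
  by_cases h : m ∉ T ∧ S = insert m T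
  · obtain ⟨h1, rfl⟩ := h
    simp [h1, star_fockSign, fockSign_insert_of_le le_rfl]
  · rw [if_neg h, if_neg, star_zero]
    rintro ⟨h1, rfl⟩
    exact h ⟨Finset.notMem_erase m S, (Finset.insert_erase h1).symm⟩

variable [Fintype α]

theorem mul_annihilate_apply (X : FockOp α) (m : α) (S T : Finset α) :
    (X * annihilate m) S T = if m ∈ T then X S (T.erase m) * fockSign m T else 0 := by
  rw [Matrix.mul_apply, Finset.sum_eq_single (T.erase m)]
  · simp [annihilate_apply]
  · intro U _ hU
    simp [annihilate_apply, hU]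
  · simp

theorem mul_create_apply (X : FockOp α) (m : α) (S T : Finset α) :
    (X * create m) S T = if m ∉ T then X S (insert m T) * fockSign m T else 0 := by
  rw [Matrix.mul_apply, Finset.sum_eq_single (insert m T)]
  · simp [create_apply]
  · intro U _ hU
    simp [create_apply, hU]
  · simp

/-- Emptying `i` flips the sign attached to the later mode `j`, while emptying `j` does not affect
`i`; the two orders therefore cancel. -/
theorem annihilate_mul_annihilate_add_of_lt {i j : α} (h : i < j) :
    annihilate i * annihilate j + annihilate j * annihilate i = 0 := by
  ext S T
  rw [Matrix.add_apply, mul_annihilate_apply, mul_annihilate_apply]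
  simp only [annihilate_apply, Finset.mem_erase, Finset.erase_right_comm (a := j) (b := i)]
  by_cases hi : i ∈ T <;> by_cases hj : j ∈ T <;> simp [hi, hj, h.ne, h.ne']
  split_ifs
  · rw [fockSign_erase_of_le h.le, fockSign_erase_of_lt h hi]
    ring
  · simp

theorem annihilate_mul_create_add_of_ne {i j : α} (h : i ≠ j) :
    annihilate i * create j + create j * annihilate i = 0 := by
  ext S T
  rw [Matrix.add_apply, mul_annihilate_apply, mul_create_apply]
  simp only [annihilate_apply, create_apply, Finset.mem_erase, Finset.mem_insert]
  by_cases hi : i ∈ T <;> by_cases hj : j ∈ T <;> simp [hi, hj, h, h.symm]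
  rw [Finset.erase_insert_of_ne h.symm]
  split_ifs
  · rcases h.lt_or_gt with hlt | hlt
    · rw [fockSign_insert_of_le hlt.le, fockSign_erase_of_lt hlt hi]
      ring
    · rw [fockSign_insert_of_lt hlt hj, fockSign_erase_of_le hlt.le]
      ring
  · simp

theorem annihilate_mul_create_add_self (i : α) :
    annihilate i * create i + create i * annihilate i = 1 := by
  ext S T
  rw [Matrix.add_apply, mul_annihilate_apply, mul_create_apply]
  simp only [annihilate_apply, create_apply, Matrix.one_apply]
  by_cases hi : i ∈ T
  · simp [hi, Finset.insert_erase, fockSign_erase_of_le le_rfl, fockSign_mul_self]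
  · simp [hi, fockSign_insert_of_le le_rfl, fockSign_mul_self]

theorem isCAR_annihilate : IsCAR (annihilate : α → FockOp α) where
  mul_add_mul i j := by
    rcases lt_trichotomy i j with h | rfl | h
    · exact annihilate_mul_annihilate_add_of_lt h
    · ext S T
      simp [mul_annihilate_apply, annihilate_apply]
    · rw [add_comm]
      exact annihilate_mul_annihilate_add_of_lt h
  mul_star_add i j := by
    change annihilate i * create j + create j * annihilate i = _
    split_ifs with h
    · rw [h, annihilate_mul_create_add_self]
    · exact annihilate_mul_create_add_of_ne h

theorem numberOp_eq_diagonal (m : α) :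
    numberOp m = Matrix.diagonal fun S : Finset α => if m ∈ S then (1 : ℂ) else 0 := by
  ext S T
  rw [numberOp, mul_annihilate_apply, create_apply, Matrix.diagonal_apply]
  by_cases hm : m ∈ T
  · by_cases hS : S = T
    · subst hS
      simp [hm, Finset.insert_erase, fockSign_erase_of_le le_rfl, fockSign_mul_self]
    · simp [hm, Finset.insert_erase, hS]
  · by_cases hS : S = T
    · subst hS
      simp [hm]
    · simp [hm, hS]

/-- The eigenvalue of `z_m` on the basis state of `S`. -/
def zValue (m : α) (S : Finset α) : ℝ := if m ∈ S then 1 else -1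

theorem zOp_eq_diagonal (m : α) :
    zOp m = Matrix.diagonal fun S : Finset α => (zValue m S : ℂ) := by
  rw [zOp, numberOp_eq_diagonal]
  ext S T
  by_cases hS : S = T
  · subst hS
    by_cases hm : m ∈ S <;> simp [zValue, hm]
    norm_num
  · simp [hS]

theorem create_mul_annihilate_apply_ne_zero {i j : α} {S T : Finset α}
    (h : (create i * annihilate j) S T ≠ 0) :
    j ∈ T ∧ i ∉ T.erase j ∧ S = insert i (T.erase j) := by
  rw [mul_annihilate_apply, create_apply] at h
  by_contra hc
  apply h
  split_ifs with h1 h2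
  · exact (hc ⟨h1, h2⟩).elim
  · rw [zero_mul]
  · rfl

end Fock

/-! ### Hopping against the diagonal interaction. -/

section Hubbard

variable {Λ : Type*} [Fintype Λ] [LinearOrder Λ]

omit [Fintype Λ] [LinearOrder Λ] in
theorem mode_injective (σ : Bool) : Function.Injective fun i : Λ => mode i σ := fun i j h => by
  simpa [mode] using h

omit [Fintype Λ] [LinearOrder Λ] in
theorem mode_inj {i j : Λ} {σ ρ : Bool} : mode i σ = mode j ρ ↔ i = j ∧ σ = ρ := by
  simp [mode]

/-- The annihilation operators of spin `σ`. -/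
def spinAnnihilate (σ : Bool) (i : Λ) : FockOp (Mode Λ) := annihilate (mode i σ)

theorem isCAR_spinAnnihilate (σ : Bool) : IsCAR (spinAnnihilate (Λ := Λ) σ) :=
  (isCAR_annihilate (α := Mode Λ)).comp (mode_injective σ)

theorem anticommuting_spinAnnihilate {σ ρ : Bool} (h : σ ≠ ρ) :
    Anticommuting (spinAnnihilate (Λ := Λ) σ) (spinAnnihilate ρ) :=
  (isCAR_annihilate (α := Mode Λ)).anticommuting (e := fun i : Λ => mode i σ)
    (e' := fun i : Λ => mode i ρ) fun _ _ hij => h (mode_inj.mp hij).2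

theorem hopping_eq {R : Matrix Λ Λ ℂ} (hR : ∀ i, R i i = 0) :
    hopping R = secondQuant (spinAnnihilate true) R + secondQuant (spinAnnihilate false) R := by
  rw [hopping, Fintype.sum_bool]
  congr 1 <;>
  · rw [secondQuant_apply]
    refine Finset.sum_congr rfl fun i _ => ?_
    rw [← Finset.add_sum_erase _ _ (Finset.mem_univ i), hR, zero_smul, zero_add]
    rfl

/-- The sum of the values `z_{i↑} z_{i↓}` in the basis state of `S`. -/
def zzValue (S : Finset (Mode Λ)) : ℝ := ∑ i : Λ, zValue (mode i true) S * zValue (mode i false) S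

theorem interaction_eq_diagonal (u : ℝ) :
    interaction Λ u = Matrix.diagonal fun S => ((u / 4 * zzValue S : ℝ) : ℂ) := by
  have h : ∑ i : Λ, zOp (mode i true) * zOp (mode i false) =
      Matrix.diagonal fun S : Finset (Mode Λ) => (zzValue S : ℂ) := by
    simp only [zOp_eq_diagonal, Matrix.diagonal_mul_diagonal]
    ext S T
    rw [Matrix.sum_apply]
    by_cases hS : S = T
    · subst hS
      simp [zzValue]
    · simp [hS]
  rw [interaction, h]
  ext S T
  by_cases hS : S = T
  · subst hS
    simp
  · simp [hS]

/-- A hop changes `z` of spin `σ` by `+2` at `i` and `-2` at `j`; each change is weighted by the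
untouched opposite spin. -/
theorem zzValue_insert_erase_sub {i j : Λ} (hij : i ≠ j) (σ : Bool) {T : Finset (Mode Λ)}
    (hj : mode j σ ∈ T) (hi : mode i σ ∉ T) :
    zzValue (insert (mode i σ) (T.erase (mode j σ))) - zzValue T =
      2 * zValue (mode i !σ) T - 2 * zValue (mode j !σ) T := by
  rw [zzValue, zzValue, ← Finset.sum_sub_distrib,
    Finset.sum_eq_add_of_mem i j (Finset.mem_univ _) (Finset.mem_univ _) hij]
  · cases σ <;> simp [zValue, mode_inj, hi, hj, hij, hij.symm] <;> split_ifs <;> norm_num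
  · intro k _ hk
    cases σ <;> simp [zValue, mode_inj, hk.1, hk.2]

theorem zzValue_sub_of_hopping_ne_zero {R : Matrix Λ Λ ℂ} {S T : Finset (Mode Λ)}
    (h : hopping R S T ≠ 0) :
    zzValue S - zzValue T = 0 ∨ zzValue S - zzValue T = 4 ∨ zzValue S - zzValue T = -4 := by
  rw [hopping, Matrix.sum_apply] at h
  obtain ⟨σ, -, h⟩ := Finset.exists_ne_zero_of_sum_ne_zero h
  rw [Matrix.sum_apply] at h
  obtain ⟨i, -, h⟩ := Finset.exists_ne_zero_of_sum_ne_zero h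
  rw [Matrix.sum_apply] at h
  obtain ⟨j, hj, h⟩ := Finset.exists_ne_zero_of_sum_ne_zero h
  have hij : i ≠ j := (Finset.ne_of_mem_erase hj).symm
  rw [Matrix.smul_apply, smul_eq_mul] at h
  obtain ⟨h1, h2, rfl⟩ := create_mul_annihilate_apply_ne_zero (right_ne_zero_of_mul h)
  have h3 : mode i σ ∉ T := fun hm =>
    h2 (Finset.mem_erase.mpr ⟨fun e => hij (mode_inj.mp e).1, hm⟩)
  rw [zzValue_insert_erase_sub hij σ h1 h3]
  unfold zValue
  split_ifs <;> norm_num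

theorem norm_lie_lie_interaction_le (R : Matrix Λ Λ ℂ) (u : ℝ) :
    ‖⁅⁅hopping R, interaction Λ u⁆, interaction Λ u⁆‖ ≤ u ^ 2 * ‖hopping R‖ := by
  -- The angle `π/4` makes the relative phase `1` for a change `Δ = 0` and `-1` for `Δ = ±4`, so `1
  -- - w S * star (w T) = Δ²/8` on every nonzero entry.
  let w : Finset (Mode Λ) → ℂ := fun S => Complex.exp ((Real.pi / 4 * zzValue S : ℝ) * Complex.I)
  have hw : ‖Matrix.diagonal w‖ ≤ 1 := by
    rw [Matrix.l2_opNorm_diagonal, pi_norm_le_iff_of_nonneg zero_le_one]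
    exact fun S => (Complex.norm_exp_ofReal_mul_I _).le
  have key : ⁅⁅hopping R, interaction Λ u⁆, interaction Λ u⁆ = ((u ^ 2 / 2 : ℝ) : ℂ) •
      (hopping R - Matrix.diagonal w * hopping R * (Matrix.diagonal w)ᴴ) := by
    ext S T
    rw [interaction_eq_diagonal, Matrix.diagonal_conjTranspose]
    simp only [Ring.lie_def, Matrix.sub_apply, Matrix.smul_apply, Matrix.mul_diagonal,
      Matrix.diagonal_mul, smul_eq_mul, Pi.star_apply]
    by_cases h : hopping R S T = 0
    · simp [h]
    have hww : w S * star (w T) =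
        Complex.exp ((Real.pi / 4 * (zzValue S - zzValue T) : ℝ) * Complex.I) := by
      simp only [w, RCLike.star_def]
      rw [← Complex.exp_conj, ← Complex.exp_add]
      congr 1
      rw [map_mul, Complex.conj_ofReal, Complex.conj_I]
      push_cast
      ring
    have hw2 : 1 - w S * star (w T) = ((zzValue S - zzValue T : ℝ) : ℂ) ^ 2 / 8 := by
      rw [hww]
      rcases zzValue_sub_of_hopping_ne_zero h with h | h | h <;> rw [h]
      · simp
      · rw [show Real.pi / 4 * 4 = Real.pi by ring, Complex.exp_pi_mul_I]
        norm_num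
      · rw [show Real.pi / 4 * -4 = -Real.pi by ring, Complex.ofReal_neg, neg_mul, Complex.exp_neg,
          Complex.exp_pi_mul_I]
        norm_num
    have e1 : hopping R S T - w S * hopping R S T * star (w T) =
        hopping R S T * (1 - w S * star (w T)) := by ring
    rw [e1, hw2]
    push_cast
    ring
  rw [key, norm_smul, Complex.norm_of_nonneg (by positivity)]
  have h1 : ‖Matrix.diagonal w * hopping R * (Matrix.diagonal w)ᴴ‖ ≤ 1 * ‖hopping R‖ * 1 := by
    refine (norm_mul_le _ _).trans ?_
    rw [Matrix.l2_opNorm_conjTranspose]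
    gcongr
    refine (norm_mul_le _ _).trans ?_
    gcongr
  have h2 := norm_sub_le (hopping R) (Matrix.diagonal w * hopping R * (Matrix.diagonal w)ᴴ)
  nlinarith [sq_nonneg u]

end Hubbard

/-! ### Commutators of the hopping with one site's occupation. -/

section Site

variable {ι 𝒜 : Type*} [Fintype ι] [DecidableEq ι] [NormedRing 𝒜] [StarRing 𝒜] [CStarRing 𝒜]
  [NormedAlgebra ℂ 𝒜] [StarModule ℂ 𝒜] [NormOneClass 𝒜] {a : ι → 𝒜} (ha : IsCAR a)

omit [Fintype ι] in
include ha in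
theorem IsCAR.norm_number_le (i : ι) : ‖(2 : ℂ) • (star (a i) * a i) - 1‖ ≤ 1 := by
  have h := norm_star_mul_sub_le zero_le_one (ha.mul_self i) (by simpa using ha.mul_star_add i i)
  have h2 : (2 : ℂ) • (star (a i) * a i) - 1 =
      (2 : ℂ) • (star (a i) * a i - ((1 / 2 : ℝ) : ℂ) • (1 : 𝒜)) := by
    push_cast
    module
  rw [h2, norm_smul, Complex.norm_ofNat]
  linarith

omit [DecidableEq ι] in
theorem lie_vecMulVec_star {R : Matrix ι ι ℂ} (hR : R.IsHermitian) (e : ι → ℂ) :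
    ⁅R, Matrix.vecMulVec e (star e)⁆ =
      Matrix.vecMulVec (R *ᵥ e) (star e) - Matrix.vecMulVec e (star (R *ᵥ e)) := by
  rw [Ring.lie_def, Matrix.mul_vecMulVec, Matrix.vecMulVec_mul, Matrix.star_mulVec, hR.eq]

omit [DecidableEq ι] in
theorem lie_lie_vecMulVec_star {R : Matrix ι ι ℂ} (hR : R.IsHermitian) (e : ι → ℂ) :
    ⁅⁅R, Matrix.vecMulVec e (star e)⁆, R⁆ =
      (2 : ℂ) • Matrix.vecMulVec (R *ᵥ e) (star (R *ᵥ e)) -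
        (Matrix.vecMulVec e (star (R *ᵥ R *ᵥ e)) + Matrix.vecMulVec (R *ᵥ R *ᵥ e) (star e)) := by
  have h : ∀ v : ι → ℂ, star v ᵥ* R = star (R *ᵥ v) := fun v => by
    rw [Matrix.star_mulVec, hR.eq]
  rw [lie_vecMulVec_star hR, Ring.lie_def, sub_mul, mul_sub, Matrix.mul_vecMulVec,
    Matrix.mul_vecMulVec, Matrix.vecMulVec_mul, Matrix.vecMulVec_mul, h, h]
  module

theorem normSqVec_single (i : ι) : normSqVec (Pi.single i (1 : ℂ)) = 1 := by
  rw [normSqVec, Finset.sum_eq_single i]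
  · simp
  · intro j _ hj
    simp [hj]
  · simp

omit [CStarRing 𝒜] [NormOneClass 𝒜] in
include ha in
theorem IsCAR.lie_secondQuant_number (R : Matrix ι ι ℂ) (i : ι) :
    ⁅secondQuant a R, (2 : ℂ) • (star (a i) * a i) - 1⁆ = (2 : ℂ) • secondQuant a
      ⁅R, Matrix.vecMulVec (Pi.single i 1) (star (Pi.single i 1))⁆ := by
  rw [← ha.lie_secondQuant, ← star_field_mul_field, field_single]
  simp only [Ring.lie_def, mul_sub, sub_mul, mul_smul_comm, smul_mul_assoc, mul_one, one_mul]
  module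

include ha in
theorem IsCAR.norm_lie_number_le {R : Matrix ι ι ℂ} (hR : R.IsHermitian) {i : ι} (h0 : R i i = 0)
    {β : ℝ} (hβ : 0 < β) (hr : normSqVec (R *ᵥ Pi.single i 1) ≤ β ^ 2) :
    ‖⁅secondQuant a R, (2 : ℂ) • (star (a i) * a i) - 1⁆‖ ≤ 2 * β := by
  set e : ι → ℂ := Pi.single i 1 with he
  -- Multiplying by `i` turns the anti-Hermitian commutator into the symmetric form with `p = e`, `s
  -- = iRe`; its scalar shift vanishes because `R i i = 0`.
  have h1 : Complex.I • ⁅R, Matrix.vecMulVec e (star e)⁆ =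
      Matrix.vecMulVec e (star (Complex.I • (R *ᵥ e))) +
        Matrix.vecMulVec (Complex.I • (R *ᵥ e)) (star e) := by
    rw [lie_vecMulVec_star hR]
    ext k l
    simp only [Matrix.smul_apply, Matrix.sub_apply, Matrix.add_apply, Matrix.vecMulVec_apply,
      Pi.star_apply, Pi.smul_apply, smul_eq_mul, star_mul', RCLike.star_def, Complex.conj_I]
    ring
  have h2 : (star e ⬝ᵥ (Complex.I • (R *ᵥ e))).re = 0 := by
    simp [he, h0]
  have h3 : normSqVec (Complex.I • (R *ᵥ e)) ≤ β ^ 2 := by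
    simpa [normSqVec] using hr
  have h4 := ha.norm_secondQuant_symm_le e (Complex.I • (R *ᵥ e)) one_pos hβ
    (by rw [normSqVec_single, one_pow]) h3
  rw [h2, ← h1, Complex.ofReal_zero, zero_smul, sub_zero, map_smul, norm_smul, Complex.norm_I,
    one_mul, one_mul] at h4
  rw [ha.lie_secondQuant_number, norm_smul, Complex.norm_ofNat]
  linarith

include ha in
theorem IsCAR.norm_lie_lie_number_le {R : Matrix ι ι ℂ} (hR : R.IsHermitian) {i : ι}
    {γ : ℝ} (hγ : 0 < γ) (hs : normSqVec (R *ᵥ R *ᵥ Pi.single i 1) ≤ γ ^ 2) :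
    ‖⁅⁅secondQuant a R, (2 : ℂ) • (star (a i) * a i) - 1⁆, secondQuant a R⁆‖ ≤
      2 * (normSqVec (R *ᵥ Pi.single i 1) + γ) := by
  set e : ι → ℂ := Pi.single i 1 with he
  set r := R *ᵥ e with hr
  have h1 : ⁅⁅secondQuant a R, (2 : ℂ) • (star (a i) * a i) - 1⁆, secondQuant a R⁆ =
      (2 : ℂ) • secondQuant a ⁅⁅R, Matrix.vecMulVec e (star e)⁆, R⁆ := by
    have hlie : ∀ x y : 𝒜, ⁅(2 : ℂ) • x, y⁆ = (2 : ℂ) • ⁅x, y⁆ := fun x y => by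
      rw [Ring.lie_def, Ring.lie_def, smul_mul_assoc, mul_smul_comm, ← smul_sub]
    rw [ha.lie_secondQuant_number, hlie, ha.lie_secondQuant]
  have h2 : (star e ⬝ᵥ (R *ᵥ r)) = (normSqVec r : ℂ) := by
    rw [Matrix.dotProduct_mulVec, ← star_dotProduct_self, hr, Matrix.star_mulVec, hR.eq]
  have h3 := ha.norm_secondQuant_symm_le e (R *ᵥ r) one_pos hγ
    (by rw [normSqVec_single, one_pow]) hs
  rw [h2, Complex.ofReal_re] at h3
  have h4 := ha.norm_secondQuant_vecMulVec_le r
  -- The scalar shifts cancel, since `⟨e, R²e⟩ = ‖Re‖²`.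
  have h5 : secondQuant a ⁅⁅R, Matrix.vecMulVec e (star e)⁆, R⁆ =
      (2 : ℂ) • (secondQuant a (Matrix.vecMulVec r (star r)) -
        ((normSqVec r / 2 : ℝ) : ℂ) • (1 : 𝒜)) -
      (secondQuant a (Matrix.vecMulVec e (star (R *ᵥ r)) + Matrix.vecMulVec (R *ᵥ r) (star e))
        - (normSqVec r : ℂ) • (1 : 𝒜)) := by
    rw [lie_lie_vecMulVec_star hR, map_sub, map_smul]
    push_cast
    module
  rw [h1, norm_smul, Complex.norm_ofNat, h5]
  have h6 := norm_sub_le ((2 : ℂ) • (secondQuant a (Matrix.vecMulVec r (star r)) -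
        ((normSqVec r / 2 : ℝ) : ℂ) • (1 : 𝒜)))
      (secondQuant a (Matrix.vecMulVec e (star (R *ᵥ r)) + Matrix.vecMulVec (R *ᵥ r) (star e))
        - (normSqVec r : ℂ) • (1 : 𝒜))
  rw [norm_smul, Complex.norm_ofNat] at h6
  linarith

/-- The double commutator of a product of two factors with a sum of two terms, when the first
factor and term commute with the second ones. -/
theorem lie_lie_mul_eq {A : Type*} [Ring A] {S T y z : A} (hST : Commute S T)
    (hSz : Commute S z) (hTy : Commute T y) :
    ⁅⁅S + T, y * z⁆, S + T⁆ =
      ⁅⁅S, y⁆, S⁆ * z + y * ⁅⁅T, z⁆, T⁆ - 2 * (⁅S, y⁆ * ⁅T, z⁆) := by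
  have h1 : ⁅S + T, y * z⁆ = ⁅S, y⁆ * z + y * ⁅T, z⁆ := by
    simp only [Ring.lie_def]
    have e1 : y * z * S = y * S * z := by rw [mul_assoc, ← hSz.eq, mul_assoc]
    have e2 : T * (y * z) = y * T * z := by rw [← mul_assoc, hTy.eq]
    rw [add_mul, mul_add, e1, e2]
    noncomm_ring
  have c1 : Commute T ⁅S, y⁆ := by
    rw [Ring.lie_def]
    exact (hST.symm.mul_right hTy).sub_right (hTy.mul_right hST.symm)
  have c2 : Commute S ⁅T, z⁆ := by
    rw [Ring.lie_def]
    exact (hST.mul_right hSz).sub_right (hSz.mul_right hST)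
  rw [h1]
  generalize hU : ⁅S, y⁆ = U at *
  generalize hV : ⁅T, z⁆ = V at *
  simp only [Ring.lie_def] at *
  have e1 : U * z * S = U * S * z := by rw [mul_assoc, ← hSz.eq, mul_assoc]
  have e2 : y * V * S = y * S * V := by rw [mul_assoc, ← c2.eq, mul_assoc]
  have e3 : T * (U * z) = U * T * z := by rw [← mul_assoc, c1.eq]
  have e4 : T * (y * V) = y * T * V := by rw [← mul_assoc, hTy.eq]
  have e5 : y * S = S * y - U := by rw [← hU]; abel
  have e6 : U * z * T = U * T * z - U * V := by rw [← hV]; noncomm_ring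
  rw [add_mul, mul_add, mul_add, mul_add, add_mul, add_mul, e1, e2, e3, e4, e5, e6]
  noncomm_ring

end Site

/-! ### Eigenmodes of the hopping matrix. -/

section Diagonalization

variable {ι 𝒜 : Type*} [Fintype ι] [DecidableEq ι]

/-- The annihilation operators of the eigenvectors of `R`. -/
def eigenAnnihilate [Ring 𝒜] [Algebra ℂ 𝒜] (a : ι → 𝒜) {R : Matrix ι ι ℂ} (hR : R.IsHermitian)
    (k : ι) : 𝒜 :=
  field a fun i => (hR.eigenvectorUnitary : Matrix ι ι ℂ) i k

variable [Ring 𝒜] [StarRing 𝒜] [Algebra ℂ 𝒜] [StarModule ℂ 𝒜] {a : ι → 𝒜}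

theorem IsCAR.eigenAnnihilate (ha : IsCAR a) {R : Matrix ι ι ℂ} (hR : R.IsHermitian) :
    IsCAR (eigenAnnihilate a hR) where
  mul_add_mul i j := ha.field_mul_field _ _
  mul_star_add i j := by
    rw [_root_.eigenAnnihilate, _root_.eigenAnnihilate, ha.field_mul_star_field]
    have h := congrFun (congrFun (Unitary.coe_star_mul_self hR.eigenvectorUnitary) i) j
    rw [Matrix.one_apply] at h
    have h' : (star (fun l => (hR.eigenvectorUnitary : Matrix ι ι ℂ) l i) ⬝ᵥ
        fun l => (hR.eigenvectorUnitary : Matrix ι ι ℂ) l j) = if i = j then 1 else 0 := h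
    rw [h']
    split_ifs <;> simp

theorem secondQuant_eq_sum_eigenvalues (a : ι → 𝒜) {R : Matrix ι ι ℂ} (hR : R.IsHermitian) :
    secondQuant a R = ∑ k, (hR.eigenvalues k : ℂ) •
      (star (eigenAnnihilate a hR k) * eigenAnnihilate a hR k) := by
  simp only [_root_.eigenAnnihilate, star_field_mul_field, ← map_smul, ← map_sum]
  congr 1
  conv_lhs => rw [hR.spectral_theorem, Unitary.conjStarAlgAut_apply]
  ext i j
  rw [Matrix.sum_apply, Matrix.mul_apply]
  refine Finset.sum_congr rfl fun k _ => ?_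
  simp [Matrix.mul_diagonal, Matrix.vecMulVec_apply, Matrix.star_apply]
  ring

end Diagonalization

/-! ### The norm of the hopping and its double commutator. -/

section Hubbard

variable {Λ : Type*} [Fintype Λ] [LinearOrder Λ]

theorem norm_hopping_eq {R : Matrix Λ Λ ℂ} (hR : R.IsHermitian) (h0 : ∀ i, R i i = 0) :
    ‖hopping R‖ = hermitianTraceNorm hR := by
  -- Trace zero makes the shift of each occupation by `1/2` free.
  have htr : ∑ k, (hR.eigenvalues k : ℂ) = 0 := by
    have := hR.trace_eq_sum_eigenvalues
    rw [Matrix.trace, Finset.sum_eq_zero fun i _ => (R.diag_apply i).trans (h0 i)] at this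
    exact this.symm
  have hq : ∀ a : Λ → FockOp (Mode Λ), secondQuant a R = ∑ k, (hR.eigenvalues k : ℂ) •
      (star (eigenAnnihilate a hR k) * eigenAnnihilate a hR k - (1 / 2 : ℂ) • 1) := fun a => by
    simp only [smul_sub, Finset.sum_sub_distrib]
    rw [← Finset.sum_smul, htr, zero_smul, sub_zero, secondQuant_eq_sum_eigenvalues]
  -- The eigenmodes of both spins form one family with each eigenvalue listed twice, which cancels
  -- the factor `1/2`.
  have hCAR := ((isCAR_spinAnnihilate (Λ := Λ) true).eigenAnnihilate hR).sumElim
    ((isCAR_spinAnnihilate (Λ := Λ) false).eigenAnnihilate hR)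
    ((anticommuting_spinAnnihilate (Λ := Λ) (by simp : true ≠ false)).field _ _)
  have h := hCAR.norm_sum_smul_eq (Sum.elim hR.eigenvalues hR.eigenvalues)
  rw [Fintype.sum_sum_type, Fintype.sum_sum_type] at h
  simp only [Sum.elim_inl, Sum.elim_inr] at h
  rw [← hq, ← hq] at h
  rw [hopping_eq h0, h, hermitianTraceNorm]
  ring

theorem zOp_mode_eq (i : Λ) (σ : Bool) : zOp (mode i σ) =
    (2 : ℂ) • (star (spinAnnihilate σ i) * spinAnnihilate σ i) - 1 := rfl

theorem commute_secondQuant_zOp {σ ρ : Bool} (h : σ ≠ ρ) (R : Matrix Λ Λ ℂ) (i : Λ) :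
    Commute (secondQuant (spinAnnihilate σ) R) (zOp (mode i ρ)) := by
  rw [zOp_mode_eq, ← field_single (spinAnnihilate ρ) i, star_field_mul_field]
  exact (((anticommuting_spinAnnihilate h).commute_secondQuant _ _).smul_right _).sub_right
    (Commute.one_right _)

/-- Each single-spin double commutator contributes `2(β² + γ)`, and the cross term contributes
`2(2β)²`. -/
theorem norm_lie_lie_site_le {R : Matrix Λ Λ ℂ} (hR : R.IsHermitian) (h0 : ∀ i, R i i = 0)
    {i : Λ} {β γ : ℝ} (hβ : 0 < β) (hγ : 0 < γ) (hr : normSqVec (R *ᵥ Pi.single i 1) ≤ β ^ 2)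
    (hs : normSqVec (R *ᵥ R *ᵥ Pi.single i 1) ≤ γ ^ 2) :
    ‖⁅⁅hopping R, zOp (mode i true) * zOp (mode i false)⁆, hopping R⁆‖ ≤
      12 * β ^ 2 + 4 * γ := by
  have hz : ∀ σ : Bool, ‖zOp (mode i σ)‖ ≤ 1 := fun σ =>
    (isCAR_spinAnnihilate (Λ := Λ) σ).norm_number_le i
  have hl : ∀ σ : Bool, ‖⁅secondQuant (spinAnnihilate σ) R, zOp (mode i σ)⁆‖ ≤ 2 * β := fun σ =>
    (isCAR_spinAnnihilate σ).norm_lie_number_le hR (h0 i) hβ hr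
  have hll : ∀ σ : Bool, ‖⁅⁅secondQuant (spinAnnihilate σ) R, zOp (mode i σ)⁆,
      secondQuant (spinAnnihilate σ) R⁆‖ ≤ 2 * (β ^ 2 + γ) := fun σ =>
    ((isCAR_spinAnnihilate σ).norm_lie_lie_number_le hR hγ hs).trans (by linarith)
  rw [hopping_eq h0, lie_lie_mul_eq
    ((anticommuting_spinAnnihilate (by simp)).commute_secondQuant R R)
    (commute_secondQuant_zOp (by simp) R i) (commute_secondQuant_zOp (by simp) R i)]
  have b1 := norm_mul_le_of_le (hll true) (hz false)
  have b2 := norm_mul_le_of_le (hz true) (hll false)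
  have b3 := norm_mul_le_of_le (hl true) (hl false)
  refine (norm_sub_le _ _).trans ?_
  rw [two_mul]
  have b4 := norm_add_le_of_le b1 b2
  have b5 := norm_add_le_of_le b3 b3
  calc _ ≤ _ := add_le_add b4 b5
    _ = _ := by ring

theorem norm_lie_lie_hopping_le {R : Matrix Λ Λ ℂ} (hR : R.IsHermitian) (h0 : ∀ i, R i i = 0)
    {β γ : ℝ} (hβ : 0 < β) (hγ : 0 < γ) (hr : ∀ i, normSqVec (R *ᵥ Pi.single i 1) ≤ β ^ 2)
    (hs : ∀ i, normSqVec (R *ᵥ R *ᵥ Pi.single i 1) ≤ γ ^ 2) {u : ℝ} (hu : 0 < u) :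
    ‖⁅⁅hopping R, interaction Λ u⁆, hopping R⁆‖ ≤
      u * Fintype.card Λ * (3 * β ^ 2 + γ) := by
  have h : ⁅⁅hopping R, interaction Λ u⁆, hopping R⁆ = ((u / 4 : ℝ) : ℂ) • ∑ i : Λ,
      ⁅⁅hopping R, zOp (mode i true) * zOp (mode i false)⁆, hopping R⁆ := by
    simp only [interaction, Ring.lie_def, Finset.sum_sub_distrib, Finset.mul_sum, Finset.sum_mul,
      mul_smul_comm, smul_mul_assoc, smul_sub, sub_mul, mul_sub]
  rw [h, norm_smul, Complex.norm_of_nonneg (by positivity)]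
  calc _ ≤ u / 4 * ∑ _i : Λ, (12 * β ^ 2 + 4 * γ) := by
        gcongr
        exact (norm_sum_le _ _).trans
          (Finset.sum_le_sum fun i _ => norm_lie_lie_site_le hR h0 hβ hγ (hr i) (hs i))
    _ = _ := by
      rw [Finset.sum_const, Finset.card_univ, nsmul_eq_mul]
      ring

theorem isHermitian_hopping {R : Matrix Λ Λ ℂ} (hR : R.IsHermitian) (h0 : ∀ i, R i i = 0) :
    (hopping R).IsHermitian := by
  have h : ∀ σ : Bool, (secondQuant (spinAnnihilate σ) R).IsHermitian := fun σ => by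
    rw [Matrix.IsHermitian, ← Matrix.star_eq_conjTranspose, secondQuant_eq_sum_eigenvalues _ hR]
    simp [star_sum, star_smul]
  rw [hopping_eq h0]
  exact (h true).add (h false)

theorem isHermitian_interaction (u : ℝ) : (interaction Λ u).IsHermitian := by
  rw [interaction_eq_diagonal, Matrix.IsHermitian, Matrix.diagonal_conjTranspose]
  congr 1
  ext S
  simp

end Hubbard

/-! ### Estimates on the periodic square lattice. -/

section Lattice

theorem normSqVec_le_of_sum_le {ι : Type*} [Fintype ι] {v : ι → ℂ} {m c : ℝ}
    (hm : ∀ i, ‖v i‖ ≤ m) (hc : ∑ i, ‖v i‖ ≤ c) (hm0 : 0 ≤ m) : normSqVec v ≤ m * c :=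
  calc normSqVec v ≤ ∑ i, m * ‖v i‖ := Finset.sum_le_sum fun i _ => by
        rw [sq]
        exact mul_le_mul_of_nonneg_right (hm i) (norm_nonneg _)
    _ ≤ m * c := by
      rw [← Finset.mul_sum]
      gcongr

theorem cycleGraph_degree_le {L : ℕ} (v : Fin L)
    [Fintype ((SimpleGraph.cycleGraph L).neighborSet v)] :
    (SimpleGraph.cycleGraph L).degree v ≤ 2 := by
  have h : (SimpleGraph.cycleGraph L).degree v < L := by
    convert SimpleGraph.degree_lt_card_verts (G := SimpleGraph.cycleGraph L) (v := v)
    rw [Fintype.card_fin]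
  -- For `L ≤ 2` the trivial bound `degree < L` suffices; this covers the degenerate cycles.
  obtain _ | _ | _ | n := L
  · omega
  · omega
  · omega
  · rw [← SimpleGraph.cycleGraph_degree_three_le (v := v)]
    exact le_of_eq (by convert rfl)

open Classical in
theorem torusGraph_degree_le {L : ℕ} (x : Fin L × Fin L) : (torusGraph L).degree x ≤ 4 := by
  have h := SimpleGraph.degree_boxProd (G := SimpleGraph.cycleGraph L)
    (H := SimpleGraph.cycleGraph L) x
  have h1 := cycleGraph_degree_le x.1
  have h2 := cycleGraph_degree_le x.2
  have h3 : (torusGraph L).degree x = (SimpleGraph.cycleGraph L).degree x.1 +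
    (SimpleGraph.cycleGraph L).degree x.2 := by
    rw [← h]
    unfold torusGraph
    convert rfl
  omega

variable {L : ℕ} (τ : ℝ)

theorem norm_latticeR_le (i j : Site L) : ‖latticeR L τ i j‖ ≤ |τ| := by
  rw [latticeR, Matrix.of_apply]
  split_ifs <;> simp

theorem latticeR_self (i : Site L) : latticeR L τ i i = 0 := by
  simp [latticeR]

theorem sum_norm_latticeR_le (i : Site L) : ∑ j, ‖latticeR L τ i j‖ ≤ 4 * |τ| := by
  classical
  have h : ∑ j, ‖latticeR L τ i j‖ =
      ∑ y : Fin L × Fin L, if (torusGraph L).Adj (ofLex i) y then |τ| else 0 := by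
    rw [← (ofLex : Site L ≃ Fin L × Fin L).sum_comp]
    refine Finset.sum_congr rfl fun j _ => ?_
    rw [latticeR, Matrix.of_apply]
    split_ifs <;> simp
  rw [h, ← Finset.sum_filter, Finset.sum_const, nsmul_eq_mul,
    ← SimpleGraph.neighborFinset_eq_filter, SimpleGraph.card_neighborFinset_eq_degree]
  gcongr
  exact_mod_cast torusGraph_degree_le _

theorem norm_latticeR_symm (i j : Site L) : ‖latticeR L τ i j‖ = ‖latticeR L τ j i‖ := by
  rw [← (latticeR_isHermitian L τ).apply i j, norm_star]

theorem normSqVec_latticeR_single_le (i : Site L) :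
    normSqVec (latticeR L τ *ᵥ Pi.single i 1) ≤ (2 * |τ|) ^ 2 := by
  refine (normSqVec_le_of_sum_le (m := |τ|) (c := 4 * |τ|) (fun j => ?_) ?_
    (abs_nonneg τ)).trans_eq (by ring)
  · simpa using norm_latticeR_le τ j i
  · simpa [norm_latticeR_symm τ _ i] using sum_norm_latticeR_le τ i

theorem normSqVec_latticeR_latticeR_single_le (i : Site L) :
    normSqVec (latticeR L τ *ᵥ latticeR L τ *ᵥ Pi.single i 1) ≤ (8 * τ ^ 2) ^ 2 := by
  have hle : ∀ j, ‖(latticeR L τ *ᵥ latticeR L τ *ᵥ Pi.single i 1) j‖ ≤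
      ∑ k, ‖latticeR L τ j k‖ * ‖latticeR L τ k i‖ := fun j => by
    rw [Matrix.mulVec_single_one, Matrix.mulVec, dotProduct]
    refine (norm_sum_le _ _).trans_eq ?_
    simp
  -- Two steps of at most four neighbours each: an entry of `R²` is at most `4τ²` and a column sums
  -- to at most `16τ²`, with product `(8τ²)²`.
  refine (normSqVec_le_of_sum_le (m := 4 * |τ| * |τ|) (c := 4 * |τ| * (4 * |τ|)) (fun j => ?_) ?_
    (by positivity)).trans_eq ?_
  · calc _ ≤ ∑ k, ‖latticeR L τ j k‖ * |τ| := (hle j).trans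
          (Finset.sum_le_sum fun k _ => by gcongr; exact norm_latticeR_le τ k i)
      _ ≤ _ := by
        rw [← Finset.sum_mul]
        gcongr
        exact sum_norm_latticeR_le τ j
  · calc _ ≤ ∑ j, ∑ k, ‖latticeR L τ j k‖ * ‖latticeR L τ k i‖ :=
          Finset.sum_le_sum fun j _ => hle j
      _ = ∑ k, (∑ j, ‖latticeR L τ k j‖) * ‖latticeR L τ k i‖ := by
        rw [Finset.sum_comm]
        refine Finset.sum_congr rfl fun k _ => ?_
        rw [Finset.sum_mul]
        simp only [norm_latticeR_symm τ _ k]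
      _ ≤ ∑ k, (4 * |τ|) * ‖latticeR L τ k i‖ := Finset.sum_le_sum fun k _ => by
        gcongr
        exact sum_norm_latticeR_le τ k
      _ ≤ _ := by
        rw [← Finset.mul_sum]
        gcongr
        simpa [norm_latticeR_symm τ _ i] using sum_norm_latticeR_le τ i
  · rw [show 4 * |τ| * |τ| * (4 * |τ| * (4 * |τ|)) = 64 * (|τ| ^ 2) ^ 2 by ring, sq_abs]
    ring

theorem norm_lie_lie_Hh_le {u : ℝ} (hu : 0 < u) :
    ‖⁅⁅Hh L τ, HI L u⁆, Hh L τ⁆‖ ≤ 2 * (u * τ ^ 2 * (L : ℝ) ^ 2 * (√5 + 8)) := by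
  -- The general bound needs `β, γ > 0`, so vanishing hopping is separate.
  by_cases hτ : τ = 0
  · have h : Hh L τ = 0 := by
      rw [← norm_eq_zero, Hh, hopping_eq (latticeR_self τ)]
      have : latticeR L τ = 0 := by
        ext i j
        simpa [hτ] using norm_latticeR_le τ i j
      simp [this]
    rw [h, hτ, Ring.lie_def]
    simp
  -- With `β = 2|τ|`, `γ = 8τ²` one has `3β² + γ = 20τ² = 2(2 + 8)τ²`; only here does `√5` enter.
  have h5 : 2 ≤ √5 := Real.le_sqrt_of_sq_le (by norm_num)
  have h := norm_lie_lie_hopping_le (latticeR_isHermitian L τ) (latticeR_self τ)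
    (β := 2 * |τ|) (γ := 8 * τ ^ 2) (by positivity) (by positivity)
    (normSqVec_latticeR_single_le τ) (normSqVec_latticeR_latticeR_single_le τ) hu
  have hcard : (Fintype.card (Site L) : ℝ) = (L : ℝ) ^ 2 := by
    rw [Fintype.card_lex, Fintype.card_prod, Fintype.card_fin]
    push_cast
    ring
  rw [hcard] at h
  calc _ ≤ _ := h
    _ = 2 * (u * τ ^ 2 * (L : ℝ) ^ 2 * (2 + 8)) := by
      rw [mul_pow, sq_abs]
      ring
    _ ≤ _ := by gcongr

theorem norm_lie_lie_HI_le (u : ℝ) : ‖⁅⁅Hh L τ, HI L u⁆, HI L u⁆‖ ≤ u ^ 2 * ‖Hh L τ‖ :=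
  norm_lie_lie_interaction_le _ u

end Lattice

theorem norm_lie_lie_swap {A : Type*} [NormedRing A] (x y z : A) :
    ‖⁅⁅x, y⁆, z⁆‖ = ‖⁅⁅y, x⁆, z⁆‖ := by
  rw [← norm_neg]
  congr 1
  simp only [Ring.lie_def]
  noncomm_ring

end

theorem theorem1 (L : ℕ) (u τ : ℝ) (hu : 0 < u) :
    (∀ t : ℝ, 0 ≤ t →
      ‖evolution (Hh L τ + HI L u) t - trotterStep (Hh L τ) (HI L u) t‖ ≤ WSO1 L u τ * t ^ 3) ∧
    (∀ t : ℝ, 0 ≤ t →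
      ‖evolution (Hh L τ + HI L u) t - trotterStep (HI L u) (Hh L τ) t‖ ≤ WSO2 L u τ * t ^ 3) ∧
    WSO1 L u τ ≤ u ^ 2 / 12 * ‖Hh L τ‖ + u * τ ^ 2 / 12 * (L : ℝ) ^ 2 * (√5 + 8) ∧
    WSO2 L u τ ≤ u * τ ^ 2 / 6 * (L : ℝ) ^ 2 * (√5 + 8) + u ^ 2 / 24 * ‖Hh L τ‖ ∧
    ‖Hh L τ‖ = hermitianTraceNorm (latticeR_isHermitian L τ) := by
  have hh : (Hh L τ).IsHermitian :=
    isHermitian_hopping (latticeR_isHermitian L τ) (latticeR_self τ)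
  have hi : (HI L u).IsHermitian := isHermitian_interaction u
  have h1 := norm_lie_lie_Hh_le (L := L) τ hu
  have h2 := norm_lie_lie_HI_le (L := L) τ u
  refine ⟨fun t ht => norm_evolution_sub_trotterStep_le hh hi ht, fun t ht => ?_, ?_, ?_,
    norm_hopping_eq _ (latticeR_self τ)⟩
  · rw [add_comm]
    exact norm_evolution_sub_trotterStep_le hi hh ht
  · rw [WSO1, trotterConst]
    linarith
  · rw [WSO2, trotterConst, norm_lie_lie_swap (HI L u), norm_lie_lie_swap (HI L u)]
    linarith
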